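/- \textbf{Setting.} Let $\gamma>-1$, $p\in[0,1]$, and let $(\mu_n)_{n\ge1}$ be positive reals, regularly varying with index $\gamma$, i.e. $\mu_{\lfloor\lambda n\rfloor}/\mu_n\to\lambda^\gamma$ for every $\lambda>0$. Put $\nu_n=\sum_{k=1}^n\mu_k$. Let $(\xi_n)_{n\ge1}$ be i.i.d. real random variables with $\mathbb E\xi_1=0$ and $\mathbb E\xi_1^2=1$, let $(\alpha_n)_{n\ge2}$ be i.i.d. Bernoulli($p$), and let $(\beta_n)_{n\ge2}$ be independent with $\mathbb P(\beta_n=k)=\mu_k/\nu_{n-1}$ for $1\le k\le n-1$; the three sequences are independent of each other. Put $X_1=\xi_1$, $X_{n+1}=\alpha_{n+1}X_{\beta_{n+1}}+(1-\alpha_{n+1})\xi_{n+1}$ for $n\ge1$, and $S_0=0$, $S_n=\sum_{k=1}^nX_k$. Let $$a_n=\prod_{i=1}^{n-1}\Bigl(1+p\,\frac{\mu_{i+1}}{\nu_i}\Bigr)^{-1},\qquad v_n^2=\sum_{k=1}^na_k^2\mu_k^2,\qquad M_n=a_n\sum_{k=1}^n\mu_kX_k,\qquad p_c=\frac{\gamma+1/2}{\gamma+1}.$$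 Let $D([0,\infty))$ be the space of real right-continuous functions with left limits on $[0,\infty)$, with the Skorohod ($J_1$) topology, its Borel $\sigma$-algebra, and the metric $d(x,y)=\sum_{m\ge1}2^{-m}\min(1,d_m(g_mx,g_my))$. Here $g_m(t)=\max(0,\min(1,m-t))$ and $$d_m(x,y)=\inf_\lambda\max\Bigl(\sup_{0\le s<t\le m}\Bigl|\log\frac{\lambda t-\lambda s}{t-s}\Bigr|,\ \sup_{0\le t\le m}|x(t)-y(\lambda t)|\Bigr),$$ the infimum being over increasing bijections $\lambda$ of $[0,m]$. \textbf{Theorem (Superdiffusive process convergence).} If $(v_n)$ is bounded, then $p\in[p_c,1]$, the sequence $M_n$ converges almost surely and in $L^2$ to a square integrable random variable $M_\infty$, and $$\bigl(a_n\mu_nS_{\lfloor nt\rfloor}:t\ge0\bigr)\longrightarrow Y:=\Bigl(\frac{p(\gamma+1)}{p(\gamma+1)-\gamma}\,t^{p(\gamma+1)-\gamma}M_\infty:t\ge0\Bigr)$$ almost surely and in $L^2$, as random elements of $D([0,\infty))$. Explicitly, writing $Z_n$ for the process on the left: almost surely $Z_n\to Y$ in the Skorohod topology; $\mathbb E[d(Z_n,Y)^2]\to0$;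 and, for every $T\ge0$, $\mathbb E\bigl[\sup_{0\le t\le T}|Z_n(t)-Y(t)|^2\bigr]\to0$. -/

import Mathlib

open Set Filter Topology MeasureTheory ProbabilityTheory
open scoped NNReal ENNReal

/-- A sequence `(c n)_{n ≥ 1}` of positive reals is regularly varying with index `ρ`. -/
def RegularlyVarying (c : ℕ → ℝ) (ρ : ℝ) : Prop :=
  (∀ n, 1 ≤ n → 0 < c n) ∧
    ∀ l : ℝ, 0 < l → Tendsto (fun n : ℕ => c ⌊l * (n : ℝ)⌋₊ / c n) atTop (𝓝 (l ^ ρ))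

/-! ## The Skorohod space `D([0,∞))` -/

/-- Real functions on `[0,∞)` that are right continuous with left limits.
At `t = 0` the left-limit condition is void, since `𝓝[<] 0 = ⊥` in `ℝ≥0`. -/
structure SkorokhodSpace where
  /-- the underlying path -/
  path : ℝ≥0 → ℝ
  right_cont : ∀ t, ContinuousWithinAt path (Ici t) t
  left_lim : ∀ t, ∃ l, Tendsto path (𝓝[<] t) (𝓝 l)

namespace SkorokhodSpace

instance : CoeFun SkorokhodSpace (fun _ => ℝ≥0 → ℝ) := ⟨path⟩

/-- Increasing bijections of `[0, T]` (they are automatically continuous). -/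
abbrev TimeChange (T : ℝ≥0) : Type := Icc (0 : ℝ≥0) T ≃o Icc (0 : ℝ≥0) T

/-- `sup_{s < t} |log ((γ t - γ s) / (t - s))|`. -/
noncomputable def distortion {T : ℝ≥0} (γ : TimeChange T) : ℝ≥0∞ :=
  ⨆ (s : Icc (0 : ℝ≥0) T) (t : Icc (0 : ℝ≥0) T) (_ : s < t),
    ENNReal.ofReal |Real.log ((((γ t : ℝ≥0) : ℝ) - ((γ s : ℝ≥0) : ℝ)) /
      (((t : ℝ≥0) : ℝ) - ((s : ℝ≥0) : ℝ)))|

/-- The (complete) Skorohod `J₁` distance on `[0, T]`: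
`inf_γ max (distortion γ) (sup_{t ≤ T} |x t - y (γ t)|)`. -/
noncomputable def distOn (T : ℝ≥0) (x y : ℝ≥0 → ℝ) : ℝ≥0∞ :=
  ⨅ γ : TimeChange T, max (distortion γ) (⨆ t : Icc (0 : ℝ≥0) T, edist (x t) (y (γ t)))

/-- The continuous cut-off equal to `1` on `[0, T - 1]`, to `T - t` on `[T - 1, T]`, and to `0`
on `[T, ∞)`. -/
def cutoff (T t : ℝ≥0) : ℝ := max 0 (min 1 ((T : ℝ) - (t : ℝ)))

/-- The Skorohod distance on `D([0,∞))`: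
`∑_{m ≥ 1} 2^{-m} min(1, d_m(g_m x, g_m y))`, with `g_m` the cut-off at `m` and `d_m` the Skorohod
distance on `[0, m]`. -/
noncomputable def skorokhodEDist (x y : SkorokhodSpace) : ℝ≥0∞ :=
  ∑' m : ℕ, (2⁻¹ : ℝ≥0∞) ^ (m + 1) *
    min 1 (distOn ((m : ℝ≥0) + 1) (fun t => cutoff ((m : ℝ≥0) + 1) t * x t)
      (fun t => cutoff ((m : ℝ≥0) + 1) t * y t))

theorem distortion_refl (T : ℝ≥0) : distortion (OrderIso.refl (Icc (0 : ℝ≥0) T)) = 0 := by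
  simp only [distortion, OrderIso.refl_apply, ENNReal.iSup_eq_zero]
  intro s t hst
  have : (0 : ℝ) < ((t : ℝ≥0) : ℝ) - ((s : ℝ≥0) : ℝ) := by
    have : (s : ℝ≥0) < (t : ℝ≥0) := hst
    have : ((s : ℝ≥0) : ℝ) < ((t : ℝ≥0) : ℝ) := by exact_mod_cast this
    linarith
  rw [div_self this.ne']
  simp

theorem le_distortion {T : ℝ≥0} (γ : TimeChange T) {s t : Icc (0 : ℝ≥0) T} (h : s < t) :
    ENNReal.ofReal |Real.log ((((γ t : ℝ≥0) : ℝ) - ((γ s : ℝ≥0) : ℝ)) /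
      (((t : ℝ≥0) : ℝ) - ((s : ℝ≥0) : ℝ)))| ≤ distortion γ :=
  le_iSup_of_le s (le_iSup_of_le t (le_iSup_of_le h le_rfl))

theorem coe_sub_pos {T : ℝ≥0} {s t : Icc (0 : ℝ≥0) T} (h : s < t) :
    (0 : ℝ) < ((t : ℝ≥0) : ℝ) - ((s : ℝ≥0) : ℝ) := by
  have h1 : (s : ℝ≥0) < (t : ℝ≥0) := h
  have : ((s : ℝ≥0) : ℝ) < ((t : ℝ≥0) : ℝ) := by exact_mod_cast h1
  linarith

theorem distortion_symm_le {T : ℝ≥0} (γ : TimeChange T) : distortion γ.symm ≤ distortion γ := by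
  refine iSup_le fun s => iSup_le fun t => iSup_le fun h => ?_
  have h' : γ.symm s < γ.symm t := γ.symm.strictMono h
  refine le_trans (le_of_eq ?_) (le_distortion γ h')
  rw [OrderIso.apply_symm_apply, OrderIso.apply_symm_apply, ← abs_neg, ← Real.log_inv, inv_div]

theorem distortion_trans_le {T : ℝ≥0} (γ δ : TimeChange T) :
    distortion (γ.trans δ) ≤ distortion γ + distortion δ := by
  refine iSup_le fun s => iSup_le fun t => iSup_le fun h => ?_
  have h' : γ s < γ t := γ.strictMono h
  have h'' : δ (γ s) < δ (γ t) := δ.strictMono h'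
  have e1 := coe_sub_pos h
  have e2 := coe_sub_pos h'
  have e3 := coe_sub_pos h''
  refine le_trans ?_ (add_le_add (le_distortion γ h) (le_distortion δ h'))
  rw [← ENNReal.ofReal_add (abs_nonneg _) (abs_nonneg _)]
  refine ENNReal.ofReal_le_ofReal ?_
  refine le_trans (le_of_eq ?_) (abs_add_le _ _)
  rw [← Real.log_mul (by positivity) (by positivity)]
  congr 2
  simp only [OrderIso.trans_apply]
  field_simp

theorem distOn_self (T : ℝ≥0) (x : ℝ≥0 → ℝ) : distOn T x x = 0 := by
  refine le_antisymm (iInf_le_of_le (OrderIso.refl _) ?_) zero_le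
  simp [distortion_refl]

theorem distOn_comm_le (T : ℝ≥0) (x y : ℝ≥0 → ℝ) : distOn T x y ≤ distOn T y x := by
  refine le_iInf fun γ => iInf_le_of_le γ.symm (max_le_max (distortion_symm_le γ) ?_)
  refine iSup_le fun t => le_iSup_of_le (γ.symm t) ?_
  rw [OrderIso.apply_symm_apply, edist_comm]

theorem distOn_triangle (T : ℝ≥0) (x y z : ℝ≥0 → ℝ) :
    distOn T x z ≤ distOn T x y + distOn T y z := by
  unfold distOn
  rw [ENNReal.iInf_add]
  refine le_iInf fun γ => ?_
  rw [ENNReal.add_iInf]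
  refine le_iInf fun δ => iInf_le_of_le (γ.trans δ) (max_le ?_ ?_)
  · exact (distortion_trans_le γ δ).trans (add_le_add (le_max_left _ _) (le_max_left _ _))
  · refine iSup_le fun t => ?_
    refine (edist_triangle _ (y (γ t)) _).trans (add_le_add ?_ ?_)
    · exact le_max_of_le_right (le_iSup (fun t : Icc (0 : ℝ≥0) T => edist (x t) (y (γ t))) t)
    · exact le_max_of_le_right
        (le_iSup (fun t : Icc (0 : ℝ≥0) T => edist (y t) (z (δ t))) (γ t))

theorem min_one_add_le (a b : ℝ≥0∞) : min 1 (a + b) ≤ min 1 a + min 1 b := by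
  rcases le_total 1 a with ha | ha
  · exact (min_le_left _ _).trans (by rw [min_eq_left ha]; exact le_self_add)
  · rcases le_total 1 b with hb | hb
    · exact (min_le_left _ _).trans (by rw [min_eq_left hb]; exact le_add_self)
    · rw [min_eq_right ha, min_eq_right hb]; exact min_le_right _ _

/-- The Skorohod (pseudo)metric, hence the Skorohod topology, on `D([0,∞))`. -/
noncomputable instance : PseudoEMetricSpace SkorokhodSpace where
  edist := skorokhodEDist
  edist_self x := by simp [skorokhodEDist, distOn_self]
  edist_comm x y := by
    simp only [skorokhodEDist]
    exact tsum_congr fun m => by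
      rw [le_antisymm (distOn_comm_le _ _ _) (distOn_comm_le _ _ _)]
  edist_triangle x y z := by
    simp only [skorokhodEDist]
    rw [← ENNReal.tsum_add]
    refine ENNReal.tsum_le_tsum fun m => ?_
    rw [← mul_add]
    refine mul_le_mul_right ?_ _
    exact (min_le_min le_rfl (distOn_triangle _ _ _ _)).trans (min_one_add_le _ _)

/-- The Borel `σ`-algebra of the Skorohod topology. -/
noncomputable instance : MeasurableSpace SkorokhodSpace := borel _

instance : BorelSpace SkorokhodSpace := ⟨rfl⟩

/-- The path `t ↦ c * s ⌊n t⌋` of `D([0,∞))`, for a real sequence `s`. -/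
noncomputable def scaledPath (c : ℝ) (s : ℕ → ℝ) (n : ℕ) : SkorokhodSpace where
  path t := c * s ⌊(n : ℝ≥0) * t⌋₊
  right_cont t := by
    have hev : ∀ᶠ u in 𝓝[≥] t, ⌊(n : ℝ≥0) * u⌋₊ = ⌊(n : ℝ≥0) * t⌋₊ := by
      have hc : Tendsto (fun u : ℝ≥0 => (n : ℝ≥0) * u) (𝓝[≥] t) (𝓝 ((n : ℝ≥0) * t)) :=
        ((continuous_const.mul continuous_id).tendsto t).mono_left nhdsWithin_le_nhds
      filter_upwards [hc.eventually_lt_const (Nat.lt_floor_add_one ((n : ℝ≥0) * t)),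
        self_mem_nhdsWithin] with u hu htu
      refine le_antisymm ?_ (Nat.floor_mono (mul_le_mul_right htu _))
      exact Nat.lt_succ_iff.mp ((Nat.floor_lt zero_le).2 (by exact_mod_cast hu))
    refine Tendsto.congr' (f₁ := fun _ => c * s ⌊(n : ℝ≥0) * t⌋₊) ?_ tendsto_const_nhds
    filter_upwards [hev] with u hu
    rw [hu]
  left_lim t := by
    have hm : Monotone (fun u : ℝ≥0 => ⌊(n : ℝ≥0) * u⌋₊) :=
      fun u v h => Nat.floor_mono (mul_le_mul_right h _)
    exact ⟨_, ((continuous_of_discreteTopology (f := fun k : ℕ => c * s k)).tendsto _).comp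
      (hm.tendsto_nhdsLT t)⟩

end SkorokhodSpace

/-! ## The walk -/

namespace RVSRRW

/-- The increments of the walk driven by innovations `x`, recollection indicators `a` and memory
variables `b`: `X 1 = x 1` and `X n = a n * X (b n) + (1 - a n) * x n` for `n ≥ 2`.
(`X 0`, and the value when `b n ∉ {1, …, n - 1}`, are irrelevant conventions.) -/
def step (x a : ℕ → ℝ) (b : ℕ → ℕ) : ℕ → ℝ
  | 0 => 0
  | 1 => x 1
  | n + 2 => a (n + 2) * (if _h : b (n + 2) < n + 2 then step x a b (b (n + 2)) else 0)
      + (1 - a (n + 2)) * x (n + 2)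
  termination_by n => n

/-- The walk `S n = X 1 + ⋯ + X n`. -/
def walk (x a : ℕ → ℝ) (b : ℕ → ℕ) (n : ℕ) : ℝ := ∑ k ∈ Finset.Icc 1 n, step x a b k

/-- `ν n = μ 1 + ⋯ + μ n`. -/
def nu (μ : ℕ → ℝ) (n : ℕ) : ℝ := ∑ k ∈ Finset.Icc 1 n, μ k

/-- `a n = ∏_{i=1}^{n-1} (1 + p μ_{i+1} / ν_i)⁻¹`. -/
noncomputable def coeff (p : ℝ) (μ : ℕ → ℝ) (n : ℕ) : ℝ :=
  ∏ i ∈ Finset.Ico 1 n, (1 + p * (μ (i + 1) / nu μ i))⁻¹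

/-- `v n = (∑_{k=1}^n a_k² μ_k²)^{1/2}`. -/
noncomputable def v (p : ℝ) (μ : ℕ → ℝ) (n : ℕ) : ℝ :=
  √(∑ k ∈ Finset.Icc 1 n, coeff p μ k ^ 2 * μ k ^ 2)

/-- `M n = a_n ∑_{k=1}^n X_k μ_k`. -/
noncomputable def mart (p : ℝ) (μ : ℕ → ℝ) (x a : ℕ → ℝ) (b : ℕ → ℕ) (n : ℕ) : ℝ :=
  coeff p μ n * ∑ k ∈ Finset.Icc 1 n, step x a b k * μ k

/-- The probabilistic input of the walk with memory sequence `μ` and recollection probability `p`: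
i.i.d. centred innovations `ξ n`, `n ≥ 1`; i.i.d. Bernoulli(`p`) variables `α n`, `n ≥ 2`;
independent memory variables `β n`, `n ≥ 2`, with `P(β n = k) = μ k / ν (n - 1)` for
`1 ≤ k ≤ n - 1`; the three sequences being independent of each other. -/
structure IsInput {Ω : Type*} [MeasurableSpace Ω] (P : Measure Ω) (p : ℝ) (μ : ℕ → ℝ)
    (ξ α : ℕ → Ω → ℝ) (β : ℕ → Ω → ℕ) : Prop where
  measurable_innovation : ∀ n, 1 ≤ n → Measurable (ξ n)
  measurable_indicator : ∀ n, 2 ≤ n → Measurable (α n)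
  measurable_memory : ∀ n, 2 ≤ n → Measurable (β n)
  indep_innovation : iIndepFun (fun n => ξ (n + 1)) P
  identDistrib_innovation : ∀ n, 1 ≤ n → IdentDistrib (ξ n) (ξ 1) P P
  integrable_innovation : Integrable (ξ 1) P
  mean_innovation : ∫ ω, ξ 1 ω ∂P = 0
  indep_indicator : iIndepFun (fun n => α (n + 2)) P
  law_indicator : ∀ n, 2 ≤ n →
    P.real {ω | α n ω = 1} = p ∧ P.real {ω | α n ω = 0} = 1 - p
  indep_memory : iIndepFun (fun n => β (n + 2)) P
  law_memory : ∀ n, 2 ≤ n → ∀ k, 1 ≤ k → k ≤ n - 1 →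
    P.real {ω | β n ω = k} = μ k / nu μ (n - 1)
  indep_innovation_choices : IndepFun (fun ω n => ξ (n + 1) ω)
    (fun ω => ((fun n => α (n + 2) ω), (fun n => β (n + 2) ω))) P
  indep_indicator_memory : IndepFun (fun ω n => α (n + 2) ω) (fun ω n => β (n + 2) ω) P

/-- The scaled walk `(a_n μ_n S_{⌊nt⌋} : t ≥ 0)` as an element of `D([0,∞))`. -/
noncomputable def process {Ω : Type*} (p : ℝ) (μ : ℕ → ℝ) (ξ α : ℕ → Ω → ℝ) (β : ℕ → Ω → ℕ)
    (n : ℕ) (ω : Ω) : SkorokhodSpace :=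
  SkorokhodSpace.scaledPath (coeff p μ n * μ n)
    (walk (fun k => ξ k ω) (fun k => α k ω) (fun k => β k ω)) n

end RVSRRW

/-!
The steps of the walk satisfy `E[X_{n+1} | F_n] = p ν_n⁻¹ ∑_{k ≤ n} μ_k X_k`, so the differences
`D_n = X_{n+1} - p ν_n⁻¹ ∑_{k ≤ n} μ_k X_k` (`RVSRRW.innov`) are orthogonal martingale differences,
bounded in `L²` (`condExp_innov`, `integral_sq_innov_le`). Two transforms of them matter. The first
is `M_n = ∑_{j<n} a_{j+1} μ_{j+1} D_j`. With the weights `w_k = 1 / (a_k ν_k)` and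
`W_n = ∑_{k<n} w_k` (`RVSRRW.weightSum`), the second is `K_n = ∑_{j<n} D_j / W_{j+2}`. The walk is
recovered from the differences and from `M` by the identity (`sum_steps_eq`)
`S_n = ∑_{j<n} D_j + p ∑_{j<n} w_j M_j`.

Analytically, everything rests on Karamata's theorem for regularly varying sequences
(`RegularlyVarying.tendsto_sum_div`). It is obtained by dominated convergence from Potter's bound,
and that bound from an Egorov type argument, which uses only the pointwise definition of regular
variation. Karamata's theorem gives `ν_n ∼ n μ_n / (γ + 1)`; since `a_n ν_n ^ p` converges to a
positive constant, `1 / (a_n μ_n)` varies regularly with index `δ = p (γ + 1) - γ`. If `v` is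
bounded, then `∑ (a_n μ_n)²` converges, so `δ ≥ 1 / 2`, which is `p ≥ p_c`. Another application of
Karamata's theorem gives `a_n μ_n W_n → (γ + 1) / δ`, so `W` is a monotone substitute for
`1 / (a_n μ_n)`, with `∑ 1 / W_n²` finite. Regular variation and monotonicity then yield
`a_n μ_n W_⌊nt⌋ → (γ + 1) / δ * t ^ δ`, uniformly on compact sets
(`tendstoUniformlyOn_weightSum`).

Both `M` and `K` have square summable differences. They therefore converge almost surely and, by
Doob's inequality, have square integrable maximal functions (`IsInput.exists_tendsto_sum_innov`).
On the event where both converge, Kronecker's lemma gives `∑_{j<n} D_j = o(W_n)` and Toeplitz's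
lemma gives `∑_{j<n} w_j M_j = (M_∞ + o(1)) W_n`, so `S_n = p M_∞ W_n + o(W_n)`
(`isLittleO_sum_steps_sub`). Locally uniform convergence of the rescaled walk follows almost surely
(`tendsto_deviation`). As the deviation on `[0, T]` is at most a constant times the sum of the two
maximal functions (`exists_deviation_le`), the convergence in `L²` follows by domination. Finally,
the Skorohod distance is controlled by the uniform distances (`edist_le_tsum`).
-/

/-! ### Regularly varying sequences -/

theorem tendsto_floor_mul_natCast_atTop {l : ℝ} (hl : 0 < l) :
    Tendsto (fun n : ℕ => ⌊l * (n : ℝ)⌋₊) atTop atTop :=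
  tendsto_nat_floor_atTop.comp (tendsto_natCast_atTop_atTop.const_mul_atTop hl)

theorem sum_Icc_one_eq_sum_range {E : Type*} [AddCommMonoid E] (f : ℕ → E) (n : ℕ) :
    ∑ k ∈ Finset.Icc 1 n, f k = ∑ k ∈ Finset.range n, f (k + 1) := by
  induction n with
  | zero => simp
  | succ n ih => rw [Finset.sum_Icc_succ_top (by omega), ih, Finset.sum_range_succ]

namespace RegularlyVarying

variable {c d : ℕ → ℝ} {ρ σ : ℝ}

theorem pos (hc : RegularlyVarying c ρ) {n : ℕ} (hn : 1 ≤ n) : 0 < c n := hc.1 n hn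

theorem natCast : RegularlyVarying (fun n => (n : ℝ)) 1 := by
  refine ⟨fun n hn => Nat.cast_pos.2 hn, fun l hl => ?_⟩
  rw [Real.rpow_one]
  exact (tendsto_nat_floor_mul_div_atTop hl.le).comp tendsto_natCast_atTop_atTop

theorem mul (hc : RegularlyVarying c ρ) (hd : RegularlyVarying d σ) :
    RegularlyVarying (fun n => c n * d n) (ρ + σ) := by
  refine ⟨fun n hn => mul_pos (hc.pos hn) (hd.pos hn), fun l hl => ?_⟩
  rw [Real.rpow_add hl]
  refine ((hc.2 l hl).mul (hd.2 l hl)).congr fun n => ?_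
  rw [mul_div_mul_comm]

theorem inv (hc : RegularlyVarying c ρ) : RegularlyVarying (fun n => (c n)⁻¹) (-ρ) := by
  refine ⟨fun n hn => inv_pos.2 (hc.pos hn), fun l hl => ?_⟩
  rw [Real.rpow_neg hl.le]
  refine ((hc.2 l hl).inv₀ (Real.rpow_pos_of_pos hl _).ne').congr fun n => ?_
  rw [inv_div_inv, inv_div]

theorem rpow (hc : RegularlyVarying c ρ) (p : ℝ) :
    RegularlyVarying (fun n => c n ^ p) (ρ * p) := by
  refine ⟨fun n hn => Real.rpow_pos_of_pos (hc.pos hn) _, fun l hl => ?_⟩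
  rw [Real.rpow_mul hl.le]
  refine ((hc.2 l hl).rpow_const (Or.inl (Real.rpow_pos_of_pos hl _).ne')).congr' ?_
  filter_upwards [eventually_ge_atTop 1,
    (tendsto_floor_mul_natCast_atTop hl).eventually_ge_atTop 1] with n hn hn'
  rw [Real.div_rpow (hc.pos hn').le (hc.pos hn).le]

/-- Regular variation is invariant under asymptotic equivalence up to a positive constant. -/
theorem of_tendsto_div (hc : RegularlyVarying c ρ) (hd : ∀ n, 1 ≤ n → 0 < d n) {L : ℝ}
    (hL : 0 < L) (h : Tendsto (fun n => d n / c n) atTop (𝓝 L)) : RegularlyVarying d ρ := by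
  refine ⟨hd, fun l hl => ?_⟩
  have h1 := h.comp (tendsto_floor_mul_natCast_atTop hl)
  have h2 := (h1.mul (hc.2 l hl)).div h hL.ne'
  rw [mul_div_cancel_left₀ _ hL.ne'] at h2
  refine h2.congr' ?_
  filter_upwards [eventually_ge_atTop 1,
    (tendsto_floor_mul_natCast_atTop hl).eventually_ge_atTop 1] with n hn hn'
  have := hc.pos hn; have := hc.pos hn'; have := hd n hn; have := hd _ hn'
  simp only [Function.comp, Pi.div_apply]
  field_simp

/-- Ratios of terms with comparable indices are bounded. By Egorov's argument, the set of
`l ∈ [1, 4]` for which `c ⌊l m⌋ / c m` is within fixed bounds for all `m ≥ N` has measure close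
to `3`; hence its dilations by `n` and by `k` meet, and `c k` and `c n` are both comparable with
the term of `c` at the integer part of a common point. -/
theorem exists_bound_of_le_two_mul (hc : RegularlyVarying c ρ) :
    ∃ K : ℝ, 0 < K ∧ ∃ N : ℕ, 1 ≤ N ∧ ∀ n k : ℕ, N ≤ n → n ≤ k → k ≤ 2 * n →
      c k ≤ K * c n ∧ c n ≤ K * c k := by
  obtain ⟨K, hK1, hK⟩ : ∃ K : ℝ, 1 < K ∧ ∀ l ∈ Icc (1 : ℝ) 4, K⁻¹ < l ^ ρ ∧ l ^ ρ < K := by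
    refine ⟨(4 : ℝ) ^ |ρ| + 1, ?_, fun l hl => ?_⟩
    · have : (0 : ℝ) < (4 : ℝ) ^ |ρ| := by positivity
      linarith
    have hl0 : 0 < l := by linarith [hl.1]
    have h1 : l ^ |ρ| ≤ (4 : ℝ) ^ |ρ| := Real.rpow_le_rpow hl0.le hl.2 (abs_nonneg _)
    have h2 : l ^ ρ ≤ l ^ |ρ| := Real.rpow_le_rpow_of_exponent_le hl.1 (le_abs_self _)
    have h3 : l ^ (-ρ) ≤ l ^ |ρ| := Real.rpow_le_rpow_of_exponent_le hl.1 (neg_le_abs _)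
    refine ⟨?_, by linarith⟩
    rw [Real.rpow_neg hl0.le] at h3
    exact inv_lt_of_inv_lt₀ (Real.rpow_pos_of_pos hl0 _) (by linarith)
  have hK0 : 0 < K := by linarith
  let good : ℕ → Set ℝ := fun N =>
    {l | ∀ m : ℕ, N ≤ m → c ⌊l * (m : ℝ)⌋₊ ≤ K * c m ∧ c m ≤ K * c ⌊l * (m : ℝ)⌋₊}
  have hmeas : ∀ N, MeasurableSet (good N) := by
    intro N
    have : good N = ⋂ m : ℕ, ⋂ _ : N ≤ m,
        {l | c ⌊l * (m : ℝ)⌋₊ ≤ K * c m ∧ c m ≤ K * c ⌊l * (m : ℝ)⌋₊} := by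
      ext l; simp [good]
    rw [this]
    refine MeasurableSet.iInter fun m => MeasurableSet.iInter fun _ => ?_
    have hf : Measurable fun l : ℝ => c ⌊l * (m : ℝ)⌋₊ :=
      (measurable_from_nat (f := c)).comp (Nat.measurable_floor.comp (measurable_id.mul_const _))
    exact (measurableSet_le hf measurable_const).inter
      (measurableSet_le measurable_const (hf.const_mul K))
  let bad : ℕ → Set ℝ := fun N => Icc 1 4 \ good N
  have hanti : Antitone bad := fun N N' h l hl =>
    ⟨hl.1, fun hg => hl.2 fun m hm => hg m (h.trans hm)⟩
  have hempty : ⋂ N, bad N = ∅ := by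
    rw [eq_empty_iff_forall_notMem]
    intro l hl
    have hlI : l ∈ Icc (1 : ℝ) 4 := (mem_iInter.1 hl 0).1
    have hl0 : 0 < l := by linarith [hlI.1]
    obtain ⟨h1, h2⟩ := hK l hlI
    obtain ⟨N, hN⟩ := eventually_atTop.1
      (((hc.2 l hl0).eventually_lt_const h2).and ((hc.2 l hl0).eventually_const_lt h1))
    refine (mem_iInter.1 hl (max N 1)).2 fun m hm => ?_
    have hcm : 0 < c m := hc.pos ((le_max_right _ _).trans hm)
    obtain ⟨h3, h4⟩ := hN m ((le_max_left _ _).trans hm)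
    refine ⟨((div_lt_iff₀ hcm).1 h3).le, ?_⟩
    have h5 := (lt_div_iff₀ hcm).1 h4
    rw [inv_mul_lt_iff₀ hK0] at h5
    exact h5.le
  have hlim : Tendsto (fun N => volume (bad N)) atTop (𝓝 0) := by
    have := tendsto_measure_iInter_atTop (μ := volume) (s := bad)
      (fun N => (measurableSet_Icc.diff (hmeas N)).nullMeasurableSet) hanti
      ⟨0, ne_top_of_le_ne_top (by simp) (measure_mono (sdiff_subset (s := Icc (1:ℝ) 4)))⟩
    rwa [hempty, measure_empty] at this
  obtain ⟨N, hN⟩ := eventually_atTop.1 (hlim.eventually_lt_const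
    (show (0 : ℝ≥0∞) < ENNReal.ofReal (1 / 2) by simp))
  refine ⟨K * K, by positivity, max N 1, le_max_right _ _, fun n k hn hnk hk => ?_⟩
  have hn1 : 1 ≤ n := (le_max_right _ _).trans hn
  have hn0 : (0 : ℝ) < n := by exact_mod_cast hn1
  have hk0 : (0 : ℝ) < k := by exact_mod_cast hn1.trans hnk
  have hnkR : (n : ℝ) ≤ k := by exact_mod_cast hnk
  have hkR : (k : ℝ) ≤ 2 * n := by exact_mod_cast hk
  have hdil : ∀ m : ℕ, N ≤ m → (0 : ℝ) < m → (m : ℝ) ≤ 2 * n →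
      volume ((fun x : ℝ => x * (m : ℝ)⁻¹) ⁻¹' bad N) ≤ ENNReal.ofReal (m * (1 / 2)) := by
    intro m hm hm0 _
    rw [Real.volume_preimage_mul_right (inv_ne_zero hm0.ne'), inv_inv, abs_of_pos hm0,
      ENNReal.ofReal_mul hm0.le]
    gcongr
    exact (hN N le_rfl).le
  obtain ⟨x, hx, hxn, hxk⟩ : ∃ x ∈ Icc (2 * n : ℝ) (4 * n),
      x * (n : ℝ)⁻¹ ∉ bad N ∧ x * (k : ℝ)⁻¹ ∉ bad N := by
    by_contra! hcon
    have hsub : Icc (2 * n : ℝ) (4 * n) ⊆ ((fun x : ℝ => x * (n : ℝ)⁻¹) ⁻¹' bad N) ∪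
        ((fun x : ℝ => x * (k : ℝ)⁻¹) ⁻¹' bad N) := by
      intro x hx
      by_cases h : x * (n : ℝ)⁻¹ ∈ bad N
      · exact Or.inl h
      · exact Or.inr (hcon x hx h)
    have h1 := (measure_mono hsub).trans (measure_union_le (μ := volume) _ _)
    rw [Real.volume_Icc] at h1
    have h2 := h1.trans (add_le_add
      (hdil n ((le_max_left _ _).trans hn) hn0 (by linarith))
      (hdil k (((le_max_left _ _).trans hn).trans hnk) hk0 hkR))
    rw [← ENNReal.ofReal_add (by positivity) (by positivity),
      ENNReal.ofReal_le_ofReal_iff (by positivity)] at h2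
    linarith
  have hmem : ∀ m : ℕ, (0 : ℝ) < m → (m : ℝ) ≤ 2 * n → (n : ℝ) ≤ m → x * (m : ℝ)⁻¹ ∉ bad N →
      x * (m : ℝ)⁻¹ ∈ good N := by
    intro m hm0 hm1 hm2 hb
    by_contra hg
    refine hb ⟨⟨?_, ?_⟩, hg⟩
    · rw [← div_eq_mul_inv, le_div_iff₀ hm0]; linarith [hx.1]
    · rw [← div_eq_mul_inv, div_le_iff₀ hm0]; linarith [hx.2]
  have hgn := hmem n hn0 (by linarith) le_rfl hxn n ((le_max_left _ _).trans hn)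
  have hgk := hmem k hk0 hkR hnkR hxk k (((le_max_left _ _).trans hn).trans hnk)
  rw [inv_mul_cancel_right₀ hn0.ne'] at hgn
  rw [inv_mul_cancel_right₀ hk0.ne'] at hgk
  constructor
  · calc c k ≤ K * c ⌊x⌋₊ := hgk.2
      _ ≤ K * (K * c n) := by gcongr; exact hgn.1
      _ = _ := by ring
  · calc c n ≤ K * c ⌊x⌋₊ := hgn.2
      _ ≤ K * (K * c k) := by gcongr; exact hgk.1
      _ = _ := by ring

/-- A regularly varying sequence of positive index is increasing up to a constant factor. -/
theorem exists_le_mul_of_le (hc : RegularlyVarying c ρ) (hρ : 0 < ρ) :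
    ∃ K : ℝ, 0 < K ∧ ∀ k n : ℕ, 1 ≤ k → k ≤ n → c k ≤ K * c n := by
  obtain ⟨K₀, hK₀, N₀, hN₀, hloc⟩ := hc.exists_bound_of_le_two_mul
  have hhalf : ∀ᶠ n : ℕ in atTop, c (n / 2) ≤ c n := by
    have h1 : (1 / 2 : ℝ) ^ ρ < 1 := Real.rpow_lt_one (by norm_num) (by norm_num) hρ
    filter_upwards [(hc.2 (1 / 2) (by norm_num)).eventually_lt_const h1, eventually_ge_atTop 1]
      with n hn hn1
    rw [div_lt_one (hc.pos hn1)] at hn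
    have : ⌊(1 / 2 : ℝ) * n⌋₊ = n / 2 := by
      rw [one_div, inv_mul_eq_div]
      exact_mod_cast Nat.floor_div_eq_div (K := ℝ) n 2
    rw [this] at hn
    exact hn.le
  obtain ⟨N₁, hN₁⟩ := eventually_atTop.1 hhalf
  let N := max N₁ (2 * N₀)
  let K₁ := ∑ k ∈ Finset.Icc 1 N, ∑ n ∈ Finset.Icc 1 N, c k / c n
  have hK₁ : ∀ k n, 1 ≤ k → k ≤ N → 1 ≤ n → n ≤ N → c k / c n ≤ K₁ := by
    intro k n hk1 hk hn1 hn
    have hnn : ∀ i ∈ Finset.Icc 1 N, ∀ j ∈ Finset.Icc 1 N, 0 ≤ c i / c j := fun i hi j hj =>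
      (div_pos (hc.pos (Finset.mem_Icc.1 hi).1) (hc.pos (Finset.mem_Icc.1 hj).1)).le
    calc c k / c n ≤ ∑ n ∈ Finset.Icc 1 N, c k / c n :=
          Finset.single_le_sum (f := fun n => c k / c n)
            (fun j hj => hnn k (Finset.mem_Icc.2 ⟨hk1, hk⟩) j hj) (Finset.mem_Icc.2 ⟨hn1, hn⟩)
      _ ≤ K₁ := Finset.single_le_sum (f := fun k => ∑ n ∈ Finset.Icc 1 N, c k / c n)
            (fun i hi => Finset.sum_nonneg fun j hj => hnn i hi j hj)
            (Finset.mem_Icc.2 ⟨hk1, hk⟩)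
  refine ⟨max K₀ K₁, lt_max_of_lt_left hK₀, ?_⟩
  intro k n hk
  induction n using Nat.strong_induction_on with
  | _ n ih =>
    intro hkn
    have hcn := hc.pos (hk.trans hkn)
    rcases le_or_gt n N with hnN | hnN
    · have := (div_le_iff₀ hcn).1 (hK₁ k n hk (hkn.trans hnN) (hk.trans hkn) hnN)
      exact this.trans (by gcongr; exact le_max_right _ _)
    · have h1 : N₁ < n := (le_max_left _ _).trans_lt hnN
      have h2 : 2 * N₀ < n := (le_max_right _ _).trans_lt hnN
      rcases le_or_gt k (n / 2) with hk2 | hk2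
      · refine (ih (n / 2) (by omega) hk2).trans ?_
        have := hN₁ n h1.le
        have : 0 < max K₀ K₁ := lt_max_of_lt_left hK₀
        gcongr
      · have := (hloc k n (by omega) hkn (by omega)).2
        exact this.trans (by gcongr; exact le_max_left _ _)

end RegularlyVarying

/-- The integral over `[0, n]` of a step function. -/
theorem integral_comp_natFloor (c : ℕ → ℝ) (n : ℕ) :
    ∫ x in (0 : ℝ)..n, c ⌊x⌋₊ = ∑ k ∈ Finset.range n, c k := by
  have hEq : ∀ k : ℕ, EqOn (fun x : ℝ => c ⌊x⌋₊) (fun _ => c k) (Ioo (k : ℝ) ((k + 1 : ℕ) : ℝ)) := by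
    intro k x hx
    have : ⌊x⌋₊ = k := by
      rw [Nat.floor_eq_iff (le_trans (Nat.cast_nonneg _) hx.1.le)]
      exact ⟨hx.1.le, by exact_mod_cast hx.2⟩
    simp only [this]
  have hle : ∀ k : ℕ, (k : ℝ) ≤ ((k + 1 : ℕ) : ℝ) := fun k => by push_cast; linarith
  have hint : ∀ k < n, IntervalIntegrable (fun x : ℝ => c ⌊x⌋₊) volume (k : ℝ) ((k + 1 : ℕ) : ℝ) := by
    intro k _
    rw [intervalIntegrable_iff_integrableOn_Ioo_of_le (hle k)]
    exact (integrableOn_congr_fun (hEq k) measurableSet_Ioo).2 (integrableOn_const (by simp))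
  have := intervalIntegral.sum_integral_adjacent_intervals hint
  rw [Nat.cast_zero] at this
  rw [← this]
  refine Finset.sum_congr rfl fun k _ => ?_
  rw [intervalIntegral.integral_of_le (hle k), integral_Ioc_eq_integral_Ioo,
    setIntegral_congr_fun measurableSet_Ioo (hEq k)]
  simp

/-- **Karamata's theorem**: partial sums of a regularly varying sequence of index `ρ > -1`. -/
theorem RegularlyVarying.tendsto_sum_div {c : ℕ → ℝ} {ρ : ℝ} (hc : RegularlyVarying c ρ)
    (hρ : -1 < ρ) :
    Tendsto (fun n : ℕ => (∑ k ∈ Finset.Icc 1 n, c k) / (n * c n)) atTop (𝓝 (1 / (ρ + 1))) := by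
  -- an exponent `τ ∈ (-1, 0]` below `ρ`, for the domination
  obtain ⟨τ, hτ1, hτ0, hτρ⟩ : ∃ τ : ℝ, -1 < τ ∧ τ ≤ 0 ∧ τ < ρ := by
    refine ⟨(min ρ 0 - 1) / 2, ?_, ?_, ?_⟩
    · have : -1 < min ρ 0 := lt_min hρ (by norm_num)
      linarith
    · have := min_le_right ρ 0
      linarith
    · have := min_le_left ρ 0
      linarith
  obtain ⟨K, hK, hpotter⟩ := (hc.mul (RegularlyVarying.natCast.rpow (-τ))).exists_le_mul_of_le
    (by linarith)
  have hratio : ∀ k n : ℕ, 1 ≤ k → k ≤ n → c k / c n ≤ K * ((k : ℝ) / n) ^ τ := by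
    intro k n hk hkn
    have h := hpotter k n hk hkn
    have hk0 : (0 : ℝ) < k := by exact_mod_cast hk
    have hn0 : (0 : ℝ) < n := by exact_mod_cast hk.trans hkn
    rw [Real.rpow_neg hk0.le, Real.rpow_neg hn0.le] at h
    have h1 := Real.rpow_pos_of_pos hk0 τ
    have h2 := Real.rpow_pos_of_pos hn0 τ
    have h3 := hc.pos (hk.trans hkn)
    rw [Real.div_rpow hk0.le hn0.le, div_le_iff₀ h3]
    rw [← div_eq_mul_inv, div_le_iff₀ h1] at h
    calc c k ≤ _ := h
      _ = _ := by field_simp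
  let c' : ℕ → ℝ := fun k => if k = 0 then 0 else c k
  have hc' : ∀ k, 1 ≤ k → c' k = c k := fun k hk => if_neg (by omega)
  have hsum : ∀ n : ℕ, 1 ≤ n →
      ∫ s in (0 : ℝ)..1, c' ⌊s * (n : ℝ)⌋₊ / c n =
        (∑ k ∈ Finset.range n, c' k) / (n * c n) := by
    intro n hn
    have hn0 : (n : ℝ) ≠ 0 := by positivity
    rw [intervalIntegral.integral_div,
      intervalIntegral.integral_comp_mul_right (fun x => c' ⌊x⌋₊) hn0, zero_mul, one_mul,
      integral_comp_natFloor, smul_eq_mul]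
    field_simp
  have hlim : Tendsto (fun n : ℕ => ∫ s in (0 : ℝ)..1, c' ⌊s * (n : ℝ)⌋₊ / c n) atTop
      (𝓝 (∫ s in (0 : ℝ)..1, s ^ ρ)) := by
    refine intervalIntegral.tendsto_integral_filter_of_dominated_convergence
      (fun s => K * ((1 / 2) ^ τ * s ^ τ)) ?_ ?_ ?_ ?_
    · refine Eventually.of_forall fun n => Measurable.aestronglyMeasurable ?_
      exact ((measurable_from_nat (f := c')).comp
        (Nat.measurable_floor.comp (measurable_id.mul_const _))).div_const _
    · filter_upwards [eventually_ge_atTop 1] with n hn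
      refine Eventually.of_forall fun s hs => ?_
      rw [uIoc_of_le zero_le_one] at hs
      have hn0 : (0 : ℝ) < n := by exact_mod_cast hn
      have hs0 := hs.1
      have hcn := hc.pos hn
      rcases Nat.eq_zero_or_pos ⌊s * (n : ℝ)⌋₊ with h0 | h0
      · rw [h0]
        simp only [c', if_true, zero_div, norm_zero]
        positivity
      · have hk : ⌊s * (n : ℝ)⌋₊ ≤ n := by
          refine Nat.floor_le_of_le ?_
          nlinarith [hs.2]
        rw [hc' _ h0, Real.norm_of_nonneg (div_pos (hc.pos h0) hcn).le]
        refine (hratio _ _ h0 hk).trans ?_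
        rw [← Real.mul_rpow (by norm_num) hs0.le]
        gcongr K * ?_
        refine Real.rpow_le_rpow_of_nonpos (by positivity) ?_ hτ0
        rw [le_div_iff₀ hn0]
        have h1 : s * n < ⌊s * (n : ℝ)⌋₊ + 1 := Nat.lt_floor_add_one _
        have h2 : (1 : ℝ) ≤ ⌊s * (n : ℝ)⌋₊ := by exact_mod_cast h0
        linarith
    · exact ((intervalIntegral.intervalIntegrable_rpow' hτ1).const_mul _).const_mul _
    · refine Eventually.of_forall fun s hs => ?_
      rw [uIoc_of_le zero_le_one] at hs
      refine (hc.2 s hs.1).congr' ?_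
      filter_upwards [(tendsto_floor_mul_natCast_atTop hs.1).eventually_ge_atTop 1] with n hn
      rw [hc' _ hn]
  rw [integral_rpow (Or.inl hρ), Real.one_rpow, Real.zero_rpow (by linarith), sub_zero] at hlim
  have h0 : Tendsto (fun n : ℕ => (1 : ℝ) / n) atTop (𝓝 0) := tendsto_one_div_atTop_nhds_zero_nat
  have := hlim.add h0
  rw [add_zero] at this
  refine this.congr' ?_
  filter_upwards [eventually_ge_atTop 1] with n hn
  have hcn := hc.pos hn
  have hn0 : (0 : ℝ) < n := by exact_mod_cast hn
  rw [hsum n hn]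
  have : ∑ k ∈ Finset.Icc 1 n, c k = ∑ k ∈ Finset.range n, c' k + c n := by
    rw [← hc' n hn, ← Finset.sum_range_succ, Finset.sum_range_succ', sum_Icc_one_eq_sum_range]
    simp [c', add_comm]
  rw [this]
  field_simp

/-- Partial sums of a regularly varying sequence of index `ρ > -1` vary regularly. -/
theorem RegularlyVarying.sum {c : ℕ → ℝ} {ρ : ℝ} (hc : RegularlyVarying c ρ) (hρ : -1 < ρ) :
    RegularlyVarying (fun n => ∑ k ∈ Finset.Icc 1 n, c k) (1 + ρ) := by
  refine (RegularlyVarying.natCast.mul hc).of_tendsto_div (fun n hn => ?_)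
    (one_div_pos.2 (by linarith : 0 < ρ + 1)) (hc.tendsto_sum_div hρ)
  exact Finset.sum_pos (fun k hk => hc.pos (Finset.mem_Icc.1 hk).1) ⟨1, by simp [hn]⟩

/-- A regularly varying sequence whose partial sums are bounded has index at most `-1`. -/
theorem RegularlyVarying.index_le_of_bddAbove {c : ℕ → ℝ} {ρ : ℝ} (hc : RegularlyVarying c ρ)
    (hb : BddAbove (range fun n => ∑ k ∈ Finset.Icc 1 n, c k)) : ρ ≤ -1 := by
  by_contra! hρ
  obtain ⟨B, hB⟩ := hb
  have hB' : ∀ n, ∑ k ∈ Finset.Icc 1 n, c k ≤ B := fun n => hB ⟨n, rfl⟩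
  have hmono : ∀ n, 1 ≤ n → c 1 ≤ ∑ k ∈ Finset.Icc 1 n, c k := fun n hn =>
    Finset.single_le_sum (f := c) (fun k hk => (hc.pos (Finset.mem_Icc.1 hk).1).le)
      (Finset.mem_Icc.2 ⟨le_rfl, hn⟩)
  have hc1 := hc.pos le_rfl
  -- by Karamata's theorem `n c_n` is eventually bounded below, so that `∑ c_n` diverges
  have hL : 1 / (ρ + 1) < 1 / (ρ + 1) + 1 := by linarith
  have hL0 : 0 < 1 / (ρ + 1) + 1 := by
    have : 0 < 1 / (ρ + 1) := one_div_pos.2 (by linarith)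
    linarith
  set L := 1 / (ρ + 1) + 1
  have hev : ∀ᶠ n : ℕ in atTop, (n : ℝ)⁻¹ ≤ L / c 1 * c n := by
    filter_upwards [(hc.tendsto_sum_div hρ).eventually_lt_const hL, eventually_ge_atTop 1]
      with n hn hn1
    have hn0 : (0 : ℝ) < n := by exact_mod_cast hn1
    have hcn := hc.pos hn1
    rw [div_lt_iff₀ (by positivity)] at hn
    rw [inv_le_iff_one_le_mul₀ hn0]
    have := (hmono n hn1).trans hn.le
    rw [div_mul_eq_mul_div, mul_comm, mul_div_assoc', le_div_iff₀ hc1]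
    linarith
  refine Real.not_summable_natCast_inv ?_
  have hs : Summable fun n : ℕ => c (n + 1) := by
    refine summable_of_sum_range_le (c := B) (fun n => (hc.pos (by omega)).le) fun n => ?_
    have h := hB' n
    rw [sum_Icc_one_eq_sum_range] at h
    simpa [add_comm] using h
  have hs' : Summable c := (summable_nat_add_iff 1).1 hs
  obtain ⟨N, hN⟩ := eventually_atTop.1 hev
  refine (summable_nat_add_iff N).1 (Summable.of_nonneg_of_le (fun n => by positivity)
    (fun n => hN (n + N) (by omega)) (((summable_nat_add_iff N).2 hs').mul_left (L / c 1)))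

/-! ### Asymptotics of the normalizing sequences -/

/-- Monotone functions converging pointwise to a continuous function on a compact interval converge
uniformly. -/
theorem tendstoUniformlyOn_Icc_of_monotone {F : ℕ → ℝ → ℝ} {f : ℝ → ℝ} {T : ℝ}
    (hF : ∀ n, MonotoneOn (F n) (Icc 0 T)) (hf : ContinuousOn f (Icc 0 T))
    (h : ∀ t ∈ Icc 0 T, Tendsto (fun n => F n t) atTop (𝓝 (f t))) :
    TendstoUniformlyOn F f atTop (Icc 0 T) := by
  rcases le_or_gt T 0 with hT | hT
  · rw [Metric.tendstoUniformlyOn_iff]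
    intro ε hε
    rcases hT.lt_or_eq with hT | rfl
    · exact Eventually.of_forall fun n x hx => absurd (hx.1.trans hx.2) hT.not_ge
    · have h0 := (Metric.tendsto_nhds.1 (h 0 (by simp))) ε hε
      filter_upwards [h0] with n hn x hx
      obtain rfl : x = 0 := le_antisymm hx.2 hx.1
      rwa [dist_comm]
  have hu := isCompact_Icc.uniformContinuousOn_of_continuous hf
  rw [Metric.tendstoUniformlyOn_iff]
  intro ε hε
  obtain ⟨η, hη, hη'⟩ := Metric.uniformContinuousOn_iff.1 hu (ε / 2) (by positivity)
  obtain ⟨N, hN⟩ := exists_nat_gt (T / η)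
  have hN0 : (0 : ℝ) < N := lt_trans (by positivity) hN
  have hmesh : T / N < η := by rw [div_lt_iff₀ hN0]; rwa [div_lt_iff₀ hη, mul_comm] at hN
  have hgrid : ∀ i : ℕ, i ≤ N → T * i / N ∈ Icc 0 T := by
    intro i hi
    have hi' : (i : ℝ) ≤ N := by exact_mod_cast hi
    refine ⟨by positivity, ?_⟩
    rw [div_le_iff₀ hN0]
    gcongr
  have hev : ∀ᶠ n in atTop, ∀ i ∈ Finset.range (N + 1),
      dist (F n (T * i / N)) (f (T * i / N)) < ε / 2 := by
    rw [Filter.eventually_all_finset]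
    intro i hi
    exact Metric.tendsto_nhds.1 (h _ (hgrid i (by simpa [Nat.lt_succ_iff] using hi))) _
      (by positivity)
  filter_upwards [hev] with n hn x hx
  -- squeeze `x` between two consecutive grid points
  obtain ⟨i, hi, h1, h2⟩ : ∃ i : ℕ, i + 1 ≤ N ∧ T * i / N ≤ x ∧ x ≤ T * (i + 1 : ℕ) / N := by
    rcases hx.2.lt_or_eq with hlt | rfl
    · refine ⟨⌊x * N / T⌋₊, ?_, ?_, ?_⟩
      · rw [Nat.add_one_le_iff, Nat.floor_lt (by have := hx.1; positivity), div_lt_iff₀ hT]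
        nlinarith
      · have := Nat.floor_le (a := x * N / T) (by have := hx.1; positivity)
        rw [le_div_iff₀ hT] at this
        rw [div_le_iff₀ hN0]
        linarith
      · have := Nat.lt_floor_add_one (x * N / T)
        rw [div_lt_iff₀ hT] at this
        rw [le_div_iff₀ hN0]
        push_cast
        linarith
    · have hN1 : 1 ≤ N := by exact_mod_cast hN0
      refine ⟨N - 1, by omega, ?_, ?_⟩
      · exact (hgrid (N - 1) (by omega)).2
      · rw [Nat.sub_add_cancel hN1, mul_div_cancel_right₀ _ hN0.ne']
  have hstep : T * (i + 1 : ℕ) / N - T * i / N = T / N := by push_cast; field_simp; ring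
  have ha := hn i (Finset.mem_range.2 (by omega))
  have hb := hn (i + 1) (Finset.mem_range.2 (by omega))
  have hma := hF n (hgrid i (by omega)) hx h1
  have hmb := hF n hx (hgrid (i + 1) hi) h2
  have hca := hη' _ (hgrid i (by omega)) _ hx (by
    rw [Real.dist_eq, abs_sub_lt_iff]; constructor <;> linarith)
  have hcb := hη' _ (hgrid (i + 1) hi) _ hx (by
    rw [Real.dist_eq, abs_sub_lt_iff]; constructor <;> linarith)
  rw [Real.dist_eq, abs_sub_lt_iff] at *
  constructor <;> linarith

namespace RVSRRW

variable {γ p : ℝ} {μ : ℕ → ℝ}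

/-- The weight `w_k = (a_k ν_k)⁻¹` with which `M_k` enters the compensator of the walk.
The value at `0` is `0`, because `ν_0 = 0`. -/
noncomputable def weight (p : ℝ) (μ : ℕ → ℝ) (k : ℕ) : ℝ := (coeff p μ k * nu μ k)⁻¹

/-- The sum `W_n = w_0 + ⋯ + w_{n-1}` of the weights. Since `w_0 = 0`, it is positive only for
`n ≥ 2`, whence the shifted index in `W_{n+2}` below. -/
noncomputable def weightSum (p : ℝ) (μ : ℕ → ℝ) (n : ℕ) : ℝ := ∑ k ∈ Finset.range n, weight p μ k

@[simp] theorem nu_zero : nu μ 0 = 0 := by simp [nu]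

theorem nu_succ (n : ℕ) : nu μ (n + 1) = nu μ n + μ (n + 1) :=
  Finset.sum_Icc_succ_top (by omega) _

@[simp] theorem weight_zero : weight p μ 0 = 0 := by simp [weight]

theorem sum_sq_coeff_mul_eq (n : ℕ) :
    ∑ k ∈ Finset.Icc 1 n, (coeff p μ k * μ k) ^ 2 = v p μ n ^ 2 := by
  rw [v, Real.sq_sqrt (Finset.sum_nonneg fun _ _ => by positivity)]
  simp only [mul_pow]

theorem bddAbove_sum_sq_coeff_mul (hv : BddAbove (range (v p μ))) :
    BddAbove (range fun n => ∑ k ∈ Finset.Icc 1 n, (coeff p μ k * μ k) ^ 2) := by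
  obtain ⟨B, hB⟩ := hv
  refine ⟨B ^ 2, ?_⟩
  rintro _ ⟨n, rfl⟩
  simp only [sum_sq_coeff_mul_eq]
  exact pow_le_pow_left₀ (Real.sqrt_nonneg _) (hB ⟨n, rfl⟩) 2

theorem summable_coeff_mul_sq (hv : BddAbove (range (v p μ))) :
    Summable fun n => (coeff p μ (n + 1) * μ (n + 1)) ^ 2 := by
  obtain ⟨B, hB⟩ := bddAbove_sum_sq_coeff_mul hv
  refine summable_of_sum_range_le (c := B) (fun n => sq_nonneg _) fun n => ?_
  rw [← sum_Icc_one_eq_sum_range fun k => (coeff p μ k * μ k) ^ 2]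
  exact hB ⟨n, rfl⟩

section Positivity

variable (hμ : RegularlyVarying μ γ) (hp : 0 ≤ p)
include hμ

theorem nu_pos {n : ℕ} (hn : 1 ≤ n) : 0 < nu μ n :=
  Finset.sum_pos (fun _ hk => hμ.pos (Finset.mem_Icc.1 hk).1) ⟨1, by simp [hn]⟩

theorem nu_nonneg (n : ℕ) : 0 ≤ nu μ n :=
  Finset.sum_nonneg fun _ hk => (hμ.pos (Finset.mem_Icc.1 hk).1).le

theorem div_nu_nonneg (n : ℕ) : 0 ≤ μ (n + 1) / nu μ n :=
  div_nonneg (hμ.pos (by omega)).le (nu_nonneg hμ n)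

include hp

theorem coeff_pos (n : ℕ) : 0 < coeff p μ n :=
  Finset.prod_pos fun i _ => inv_pos.2 (by
    have := mul_nonneg hp (div_nu_nonneg hμ i)
    linarith)

theorem weight_nonneg (n : ℕ) : 0 ≤ weight p μ n :=
  inv_nonneg.2 (mul_nonneg (coeff_pos hμ hp n).le (nu_nonneg hμ n))

theorem weight_pos {n : ℕ} (hn : 1 ≤ n) : 0 < weight p μ n :=
  inv_pos.2 (mul_pos (coeff_pos hμ hp n) (nu_pos hμ hn))

theorem weightSum_mono : Monotone (weightSum p μ) := fun _ _ h =>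
  Finset.sum_le_sum_of_subset_of_nonneg (Finset.range_mono h) fun _ _ _ => weight_nonneg hμ hp _

theorem weightSum_nonneg (n : ℕ) : 0 ≤ weightSum p μ n :=
  Finset.sum_nonneg fun _ _ => weight_nonneg hμ hp _

theorem weightSum_pos (n : ℕ) : 0 < weightSum p μ (n + 2) := by
  refine lt_of_lt_of_le ?_ (weightSum_mono hμ hp (show 2 ≤ n + 2 by omega))
  simpa [weightSum, Finset.sum_range_succ] using weight_pos hμ hp le_rfl

/-- The recursion that makes `M` a martingale: `a_{n+1} (ν_n + p μ_{n+1}) = a_n ν_n`. -/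
theorem coeff_succ_mul (n : ℕ) :
    coeff p μ (n + 1) * (1 + p * (μ (n + 1) / nu μ n)) = coeff p μ n := by
  have h1 : 1 + p * (μ (n + 1) / nu μ n) ≠ 0 := by
    have := mul_nonneg hp (div_nu_nonneg hμ n)
    linarith
  rcases Nat.eq_zero_or_pos n with rfl | hn
  · simp [coeff]
  · rw [coeff, Finset.prod_Ico_succ_top hn, ← coeff, inv_mul_cancel_right₀ h1]

end Positivity

/-! #### Regular variation of the normalizations -/

section Asymptotics

variable (hγ : -1 < γ) (hμ : RegularlyVarying μ γ)
include hγ hμ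

theorem tendsto_mul_div_nu : Tendsto (fun n : ℕ => n * μ n / nu μ n) atTop (𝓝 (γ + 1)) := by
  have h := (hμ.tendsto_sum_div hγ).inv₀ (by
    have : 0 < γ + 1 := by linarith
    positivity)
  rw [one_div, inv_inv] at h
  exact h.congr fun n => by rw [inv_div, nu]

theorem exists_div_nu_le : ∃ C : ℝ, ∀ᶠ n : ℕ in atTop, μ (n + 1) / nu μ n ≤ C / (n + 1) := by
  -- `y = μ_{n+1} / ν_{n+1}` is at most `(γ + 2) / (n + 1)`, and the ratio is `y / (1 - y) ≤ 2 y`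
  refine ⟨2 * (γ + 2), ?_⟩
  have h1 := (tendsto_add_atTop_iff_nat 1).2 (tendsto_mul_div_nu hγ hμ)
  filter_upwards [h1.eventually_lt_const (show γ + 1 < γ + 2 by linarith),
    eventually_ge_atTop ⌈2 * (γ + 2)⌉₊, eventually_ge_atTop 1] with n hn hn2 hn1
  have hν := nu_pos hμ hn1
  have hν' := nu_pos hμ (show 1 ≤ n + 1 by omega)
  have hm := hμ.pos (show 1 ≤ n + 1 by omega)
  have hn0 : (0 : ℝ) < n + 1 := by positivity
  have hn2' : 2 * (γ + 2) ≤ n := Nat.ceil_le.1 hn2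
  rw [div_lt_iff₀ hν', nu_succ] at hn
  push_cast at hn
  rw [div_le_div_iff₀ hν hn0]
  nlinarith

theorem regularlyVarying_nu : RegularlyVarying (nu μ) (1 + γ) := hμ.sum hγ

variable (hp0 : 0 ≤ p) (hp1 : p ≤ 1)
include hp0 hp1

/-- `a_n` is asymptotically a constant multiple of `ν_n ^ (-p)`: the terms
`p log (1 + x) - log (1 + p x)`, with `x = μ_{i+1} / ν_i = O(1 / i)`, are of order `x²`. -/
theorem exists_tendsto_coeff_mul_nu_rpow :
    ∃ L : ℝ, 0 < L ∧ Tendsto (fun n => coeff p μ n * nu μ n ^ p) atTop (𝓝 L) := by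
  let x : ℕ → ℝ := fun i => μ (i + 1) / nu μ i
  have hx0 : x 0 = 0 := by simp [x]
  have hx : ∀ i, 0 ≤ x i := div_nu_nonneg hμ
  let t : ℕ → ℝ := fun i => p * Real.log (1 + x i) - Real.log (1 + p * x i)
  have hcoeff : ∀ n, 1 ≤ n → coeff p μ n = Real.exp (-∑ i ∈ Finset.range n, Real.log (1 + p * x i)) := by
    intro n hn
    rw [Real.exp_neg, Real.exp_sum, ← Finset.prod_inv_distrib, coeff,
      Finset.range_eq_Ico, Finset.prod_eq_prod_Ico_succ_bot hn]
    simp only [hx0, mul_zero, add_zero, Real.log_one, Real.exp_zero, inv_one, one_mul, zero_add]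
    refine Finset.prod_congr rfl fun i _ => ?_
    rw [Real.exp_log (by nlinarith [hx i])]
  have hnu : ∀ n, 1 ≤ n → nu μ n = μ 1 * Real.exp (∑ i ∈ Finset.range n, Real.log (1 + x i)) := by
    intro n hn
    induction n, hn using Nat.le_induction with
    | base => simp [nu, hx0]
    | succ n hn ih =>
      have := nu_pos hμ hn
      rw [Finset.sum_range_succ, Real.exp_add, ← mul_assoc, ← ih,
        Real.exp_log (by linarith [hx n]), nu_succ]
      simp only [x]
      field_simp
  have hprod : ∀ n, 1 ≤ n →
      μ 1 ^ p * Real.exp (∑ i ∈ Finset.range n, t i) = coeff p μ n * nu μ n ^ p := by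
    intro n hn
    rw [hcoeff n hn, hnu n hn, Real.mul_rpow (hμ.pos le_rfl).le (Real.exp_pos _).le,
      ← Real.exp_mul, mul_left_comm, ← Real.exp_add]
    congr 2
    simp only [t, Finset.sum_sub_distrib, ← Finset.mul_sum]
    ring
  have ht : ∀ i, |t i| ≤ x i ^ 2 := by
    intro i
    have hxi := hx i
    have hpx : p * x i ≤ x i := by nlinarith
    have hpx0 : 0 ≤ p * x i := by positivity
    have e1 : Real.log (1 + x i) ≤ x i := by
      have := Real.log_le_sub_one_of_pos (show 0 < 1 + x i by linarith); linarith
    have e2 : Real.log (1 + p * x i) ≤ p * x i := by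
      have := Real.log_le_sub_one_of_pos (show 0 < 1 + p * x i by linarith); linarith
    have lower : ∀ y : ℝ, 0 ≤ y → y - y ^ 2 ≤ Real.log (1 + y) := by
      intro y hy
      have := Real.one_sub_inv_le_log_of_pos (show 0 < 1 + y by linarith)
      refine le_trans ?_ this
      have : 1 - (1 + y)⁻¹ = y / (1 + y) := by field_simp; ring
      rw [this, le_div_iff₀ (by linarith)]
      nlinarith [pow_nonneg hy 3]
    have e3 := lower _ hxi
    have e4 := lower _ hpx0
    simp only [t]
    rw [abs_le]
    constructor
    · nlinarith [mul_nonneg hp0 (sq_nonneg (x i))]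
    · nlinarith [mul_nonneg hp0 (sq_nonneg (x i)), mul_self_le_mul_self hpx0 hpx]
  have hsum : Summable t := by
    obtain ⟨C, hC⟩ := exists_div_nu_le hγ hμ
    have hS : Summable fun n : ℕ => C ^ 2 * (1 / ((n : ℝ) + 1) ^ 2) := by
      refine Summable.mul_left _ ?_
      have := (summable_nat_add_iff 1).2 (Real.summable_one_div_nat_pow.2 (show 1 < 2 by norm_num))
      exact_mod_cast this
    refine Summable.of_norm_bounded_eventually_nat hS ?_
    filter_upwards [hC] with n hn
    rw [Real.norm_eq_abs]
    refine (ht n).trans ?_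
    calc x n ^ 2 ≤ (C / (n + 1)) ^ 2 := pow_le_pow_left₀ (hx n) hn 2
      _ = _ := by rw [div_pow]; ring
  refine ⟨μ 1 ^ p * Real.exp (∑' i, t i), ?_, ?_⟩
  · have := Real.rpow_pos_of_pos (hμ.pos le_rfl) p
    positivity
  · refine (((Real.continuous_exp.tendsto _).comp
      hsum.hasSum.tendsto_sum_nat).const_mul (μ 1 ^ p)).congr' ?_
    filter_upwards [eventually_ge_atTop 1] with n hn
    exact hprod n hn

theorem regularlyVarying_coeff : RegularlyVarying (coeff p μ) ((1 + γ) * (-p)) := by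
  obtain ⟨L, hL, h⟩ := exists_tendsto_coeff_mul_nu_rpow hγ hμ hp0 hp1
  refine ((regularlyVarying_nu hγ hμ).rpow (-p)).of_tendsto_div
    (fun n _ => coeff_pos hμ hp0 n) hL (h.congr fun n => ?_)
  rw [Real.rpow_neg (nu_nonneg hμ n), div_inv_eq_mul]

theorem regularlyVarying_coeff_mul :
    RegularlyVarying (fun n => coeff p μ n * μ n) (-(p * (γ + 1) - γ)) := by
  convert (regularlyVarying_coeff hγ hμ hp0 hp1).mul hμ using 1
  ring

theorem regularlyVarying_weight : RegularlyVarying (weight p μ) (p * (γ + 1) - γ - 1) := by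
  have h := ((regularlyVarying_coeff hγ hμ hp0 hp1).mul (regularlyVarying_nu hγ hμ)).inv
  rwa [show -((1 + γ) * -p + (1 + γ)) = p * (γ + 1) - γ - 1 by ring] at h

/-- If `v` is bounded, then `∑ (a_k μ_k)²` converges, which bounds the index of `a_k μ_k`. -/
theorem one_half_le_index (hv : BddAbove (range (v p μ))) : 1 / 2 ≤ p * (γ + 1) - γ := by
  have h := regularlyVarying_coeff_mul hγ hμ hp0 hp1
  have h2 := (h.mul h).index_le_of_bddAbove (by
    simpa only [← sq] using bddAbove_sum_sq_coeff_mul hv)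
  linarith

variable (hδ : 0 < p * (γ + 1) - γ)
include hδ

/-- `a_n μ_n W_n → (γ + 1) / (p (γ + 1) - γ)`, where `W_n = w_0 + ⋯ + w_n`. -/
theorem tendsto_coeff_mul_weightSum_succ :
    Tendsto (fun n => coeff p μ n * μ n * weightSum p μ (n + 1)) atTop
      (𝓝 ((γ + 1) / (p * (γ + 1) - γ))) := by
  have h1 := (regularlyVarying_weight hγ hμ hp0 hp1).tendsto_sum_div (by linarith)
  have h2 := h1.mul (tendsto_mul_div_nu hγ hμ)
  rw [sub_add_cancel, one_div_mul_eq_div] at h2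
  refine h2.congr' ?_
  filter_upwards [eventually_ge_atTop 1] with n hn
  have hν := nu_pos hμ hn
  have ha := coeff_pos hμ hp0 n
  have : weightSum p μ (n + 1) = ∑ k ∈ Finset.Icc 1 n, weight p μ k := by
    rw [weightSum, Finset.sum_range_succ', sum_Icc_one_eq_sum_range, weight_zero, add_zero]
  have hn0 : (0 : ℝ) < n := by exact_mod_cast hn
  rw [← this, weight]
  field_simp

theorem tendsto_coeff_mul_weightSum :
    Tendsto (fun n => coeff p μ n * μ n * weightSum p μ n) atTop
      (𝓝 ((γ + 1) / (p * (γ + 1) - γ))) := by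
  have h1 := tendsto_coeff_mul_weightSum_succ hγ hμ hp0 hp1 hδ
  have h2 := (tendsto_mul_div_nu hγ hμ).mul (tendsto_one_div_atTop_nhds_zero_nat (𝕜 := ℝ))
  rw [mul_zero] at h2
  have h3 := h1.sub h2
  rw [sub_zero] at h3
  refine h3.congr' ?_
  filter_upwards [eventually_ge_atTop 1] with n hn
  have hν := nu_pos hμ hn
  have ha := coeff_pos hμ hp0 n
  have hn0 : (0 : ℝ) < n := by exact_mod_cast hn
  rw [weightSum, Finset.sum_range_succ, ← weightSum, weight]
  field_simp
  ring

/-- The rescaled sums of weights converge to a power function, uniformly on compact sets. -/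
theorem tendstoUniformlyOn_weightSum (T : ℝ) :
    TendstoUniformlyOn (fun (n : ℕ) (t : ℝ) => coeff p μ n * μ n * weightSum p μ ⌊(n : ℝ) * t⌋₊)
      (fun t => (γ + 1) / (p * (γ + 1) - γ) * t ^ (p * (γ + 1) - γ)) atTop (Icc 0 T) := by
  -- the value at `n = 0` involves `μ 0`, of unknown sign, and is discarded
  suffices h : TendstoUniformlyOn (fun (n : ℕ) (t : ℝ) =>
      coeff p μ (n + 1) * μ (n + 1) * weightSum p μ ⌊((n + 1 : ℕ) : ℝ) * t⌋₊)
      (fun t => (γ + 1) / (p * (γ + 1) - γ) * t ^ (p * (γ + 1) - γ)) atTop (Icc 0 T) by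
    rw [Metric.tendstoUniformlyOn_iff] at h ⊢
    intro ε hε
    obtain ⟨N, hN⟩ := eventually_atTop.1 (h ε hε)
    filter_upwards [eventually_ge_atTop (N + 1)] with n hn
    obtain ⟨m, rfl⟩ : ∃ m, n = m + 1 := ⟨n - 1, by omega⟩
    exact hN m (by omega)
  have hb := regularlyVarying_coeff_mul hγ hμ hp0 hp1
  refine tendstoUniformlyOn_Icc_of_monotone (fun n s _ t _ hst => ?_) ?_ fun t ht => ?_
  · have := hb.pos (show 1 ≤ n + 1 by omega)
    gcongr
    refine weightSum_mono hμ hp0 (Nat.floor_mono ?_)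
    gcongr
  · exact (continuous_const.mul (Real.continuous_rpow_const hδ.le)).continuousOn
  · refine (tendsto_add_atTop_iff_nat (f := fun n : ℕ =>
      coeff p μ n * μ n * weightSum p μ ⌊(n : ℝ) * t⌋₊) 1).2 ?_
    rcases ht.1.eq_or_lt with rfl | ht0
    · simp [Real.zero_rpow hδ.ne', weightSum]
    have hfl := tendsto_floor_mul_natCast_atTop ht0
    have h1 := (tendsto_coeff_mul_weightSum hγ hμ hp0 hp1 hδ).comp hfl
    have h2 := h1.mul ((hb.2 t ht0).inv₀ (Real.rpow_pos_of_pos ht0 _).ne')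
    rw [Real.rpow_neg ht0.le, inv_inv] at h2
    refine h2.congr' ?_
    filter_upwards [hfl.eventually_ge_atTop 1] with n hn
    have := hb.pos hn
    simp only [Function.comp]
    rw [inv_div, mul_comm (n : ℝ) t]
    have hc := coeff_pos hμ hp0 ⌊t * (n : ℝ)⌋₊
    have hm := hμ.pos hn
    field_simp

theorem exists_weightSum_add_two_le :
    ∃ C : ℝ, 0 < C ∧ ∀ᶠ n in atTop, weightSum p μ (n + 2) ≤ C * weightSum p μ n := by
  have h1 := tendsto_coeff_mul_weightSum_succ hγ hμ hp0 hp1 hδ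
  have h2 := tendsto_coeff_mul_weightSum hγ hμ hp0 hp1 hδ
  have hκ : (γ + 1) / (p * (γ + 1) - γ) ≠ 0 := by
    have : 0 < γ + 1 := by linarith
    positivity
  have hb := regularlyVarying_coeff_mul hγ hμ hp0 hp1
  have h3 : Tendsto (fun n => weightSum p μ (n + 1) / weightSum p μ n) atTop (𝓝 1) := by
    have := h1.div h2 hκ
    rw [div_self hκ] at this
    refine this.congr' ?_
    filter_upwards [eventually_ge_atTop 1] with n hn
    rw [Pi.div_apply, mul_div_mul_left _ _ (hb.pos hn).ne']
  have h4 : ∀ᶠ n in atTop, weightSum p μ (n + 1) ≤ 2 * weightSum p μ n := by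
    filter_upwards [h3.eventually_lt_const (show (1 : ℝ) < 2 by norm_num), eventually_ge_atTop 2]
      with n hn hn2
    obtain ⟨m, rfl⟩ : ∃ m, n = m + 2 := ⟨n - 2, by omega⟩
    exact ((div_lt_iff₀ (weightSum_pos hμ hp0 m)).1 hn).le
  refine ⟨4, by norm_num, ?_⟩
  filter_upwards [h4, (tendsto_add_atTop_nat 1).eventually h4] with n hn hn'
  linarith

theorem summable_inv_weightSum_sq (hv : BddAbove (range (v p μ))) :
    Summable fun n => ((weightSum p μ (n + 2))⁻¹) ^ 2 := by
  have hs := summable_coeff_mul_sq hv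
  have hκ : 0 < (γ + 1) / (p * (γ + 1) - γ) := by
    have : 0 < γ + 1 := by linarith
    positivity
  have h2 := (tendsto_add_atTop_iff_nat 1).2 (tendsto_coeff_mul_weightSum_succ hγ hμ hp0 hp1 hδ)
  refine Summable.of_norm_bounded_eventually_nat
    (hs.mul_left ((((γ + 1) / (p * (γ + 1) - γ) / 2)⁻¹) ^ 2)) ?_
  filter_upwards [h2.eventually_const_lt (half_lt_self hκ)] with n hn
  have hU := weightSum_pos hμ hp0 n
  rw [Real.norm_of_nonneg (sq_nonneg _), ← mul_pow]
  refine pow_le_pow_left₀ (inv_nonneg.2 hU.le) ?_ 2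
  rw [inv_le_iff_one_le_mul₀ hU, mul_assoc, ← div_eq_inv_mul, le_div_iff₀ (by positivity), one_mul]
  exact hn.le

theorem tendsto_weightSum_atTop (hv : BddAbove (range (v p μ))) :
    Tendsto (fun n => weightSum p μ (n + 2)) atTop atTop := by
  have h := (summable_inv_weightSum_sq hγ hμ hp0 hp1 hδ hv).tendsto_atTop_zero
  have h1 : Tendsto (fun n => (weightSum p μ (n + 2))⁻¹) atTop (𝓝 0) := by
    have := (Real.continuous_sqrt.tendsto _).comp h
    rw [Real.sqrt_zero] at this
    exact this.congr fun n => Real.sqrt_sq (inv_nonneg.2 (weightSum_pos hμ hp0 n).le)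
  have h2 : Tendsto (fun n => (weightSum p μ (n + 2))⁻¹) atTop (𝓝[>] 0) :=
    tendsto_nhdsWithin_iff.2 ⟨h1, Eventually.of_forall fun n => inv_pos.2 (weightSum_pos hμ hp0 n)⟩
  exact (tendsto_inv_nhdsGT_zero.comp h2).congr fun n => inv_inv _

end Asymptotics

end RVSRRW

open Asymptotics

/-! ### Kronecker's lemma -/

theorem sum_mul_eq_sub_sum_sub_mul (c y : ℕ → ℝ) (n : ℕ) :
    ∑ j ∈ Finset.range n, c j * y j = c n * ∑ j ∈ Finset.range n, y j -
      ∑ j ∈ Finset.range n, (c (j + 1) - c j) * ∑ i ∈ Finset.range (j + 1), y i := by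
  induction n with
  | zero => simp
  | succ n ih =>
    rw [Finset.sum_range_succ, ih,
      Finset.sum_range_succ (fun j => (c (j + 1) - c j) * ∑ i ∈ Finset.range (j + 1), y i) n,
      Finset.sum_range_succ y n]
    ring

/-- **Toeplitz's lemma**: weighted averages of a convergent sequence converge to the same limit. -/
theorem isLittleO_sum_mul_sub {w x : ℕ → ℝ} {L : ℝ} (hw : ∀ n, 0 ≤ w n)
    (hW : Tendsto (fun n => ∑ k ∈ Finset.range n, w k) atTop atTop)
    (hx : Tendsto x atTop (𝓝 L)) :
    (fun n => ∑ k ∈ Finset.range n, w k * (x k - L)) =o[atTop]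
      fun n => ∑ k ∈ Finset.range n, w k := by
  refine IsLittleO.sum_range ?_ hw hW
  have h : (fun n => x n - L) =o[atTop] fun _ => (1 : ℝ) :=
    (isLittleO_one_iff ℝ).2 (tendsto_sub_nhds_zero_iff.2 hx)
  simpa using (isBigO_refl w atTop).mul_isLittleO h

/-- **Kronecker's lemma**. -/
theorem isLittleO_sum_mul_of_tendsto {c y : ℕ → ℝ} {L : ℝ} (hc : Monotone c)
    (hc' : Tendsto c atTop atTop)
    (hy : Tendsto (fun n => ∑ j ∈ Finset.range n, y j) atTop (𝓝 L)) :
    (fun n => ∑ j ∈ Finset.range n, c j * y j) =o[atTop] c := by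
  have htel : ∀ n, ∑ j ∈ Finset.range n, (c (j + 1) - c j) = c n - c 0 := fun n =>
    Finset.sum_range_sub c n
  have hconst : ∀ b : ℝ, (fun _ : ℕ => b) =o[atTop] c := fun b =>
    isLittleO_const_left.2 (Or.inr (tendsto_norm_atTop_atTop.comp hc'))
  have h1 : (fun n => c n * (∑ j ∈ Finset.range n, y j - L)) =o[atTop] c := by
    have h : (fun n => ∑ j ∈ Finset.range n, y j - L) =o[atTop] fun _ => (1 : ℝ) :=
      (isLittleO_one_iff ℝ).2 (tendsto_sub_nhds_zero_iff.2 hy)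
    simpa using (isBigO_refl c atTop).mul_isLittleO h
  have h2 : (fun n => ∑ j ∈ Finset.range n, (c (j + 1) - c j) *
      (∑ i ∈ Finset.range (j + 1), y i - L)) =o[atTop] c := by
    have h := isLittleO_sum_mul_sub (w := fun j => c (j + 1) - c j)
      (x := fun j => ∑ i ∈ Finset.range (j + 1), y i) (L := L)
      (fun j => sub_nonneg.2 (hc j.le_succ))
      (by
        simp only [htel]
        exact (tendsto_atTop_add_const_right _ (-c 0) hc').congr fun n => (sub_eq_add_neg _ _).symm)
      ((tendsto_add_atTop_iff_nat 1).2 hy)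
    simp only [htel] at h
    exact h.trans_isBigO ((isBigO_refl c atTop).sub (hconst _).isBigO)
  refine ((h1.sub h2).add (hconst (c 0 * L))).congr_left fun n => ?_
  rw [sum_mul_eq_sub_sum_sub_mul c y n]
  simp only [mul_sub, Finset.sum_sub_distrib, ← Finset.sum_mul, htel]
  ring

theorem abs_sum_mul_le {c y : ℕ → ℝ} {R : ℝ} (hc : Monotone c) (hc0 : 0 ≤ c 0)
    (hR : ∀ n, |∑ j ∈ Finset.range n, y j| ≤ R) (n : ℕ) :
    |∑ j ∈ Finset.range n, c j * y j| ≤ 2 * c n * R := by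
  have hcn : 0 ≤ c n := hc0.trans (hc (Nat.zero_le n))
  have hR0 : 0 ≤ R := (abs_nonneg _).trans (hR 0)
  rw [sum_mul_eq_sub_sum_sub_mul]
  refine (abs_sub _ _).trans ?_
  have h1 : |c n * ∑ j ∈ Finset.range n, y j| ≤ c n * R := by
    rw [abs_mul, abs_of_nonneg hcn]
    gcongr
    exact hR n
  have h2 : |∑ j ∈ Finset.range n, (c (j + 1) - c j) * ∑ i ∈ Finset.range (j + 1), y i| ≤
      (c n - c 0) * R := by
    rw [← Finset.sum_range_sub, Finset.sum_mul]
    refine (Finset.abs_sum_le_sum_abs _ _).trans (Finset.sum_le_sum fun j _ => ?_)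
    have := sub_nonneg.2 (hc j.le_succ)
    rw [abs_mul, abs_of_nonneg this]
    gcongr
    exact hR _
  nlinarith

/-! ### The walk as a functional of the martingale differences -/

namespace RVSRRW

/-- The martingale difference `D_j = X_{j+1} - p ν_j⁻¹ ∑_{k ≤ j} μ_k X_k` of the steps `X`.
For `j = 0` the quotient is `0 / 0 = 0`, so that `D_0 = X_1`. -/
noncomputable def innov (p : ℝ) (μ X : ℕ → ℝ) (j : ℕ) : ℝ :=
  X (j + 1) - p * ((∑ k ∈ Finset.Icc 1 j, X k * μ k) / nu μ j)

variable {γ p : ℝ} {μ : ℕ → ℝ} (hμ : RegularlyVarying μ γ) (hp : 0 ≤ p)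
include hμ hp

theorem coeff_mul_sum_eq (X : ℕ → ℝ) (n : ℕ) :
    coeff p μ n * ∑ k ∈ Finset.Icc 1 n, X k * μ k =
      ∑ j ∈ Finset.range n, coeff p μ (j + 1) * μ (j + 1) * innov p μ X j := by
  induction n with
  | zero => simp
  | succ n ih =>
    rw [Finset.sum_range_succ, ← ih, Finset.sum_Icc_succ_top (by omega), innov,
      ← coeff_succ_mul hμ hp n]
    ring

theorem sum_steps_eq (X : ℕ → ℝ) (n : ℕ) :
    ∑ k ∈ Finset.Icc 1 n, X k = ∑ j ∈ Finset.range n, innov p μ X j +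
      p * ∑ j ∈ Finset.range n, weight p μ j *
        (coeff p μ j * ∑ k ∈ Finset.Icc 1 j, X k * μ k) := by
  rw [sum_Icc_one_eq_sum_range, Finset.mul_sum, ← Finset.sum_add_distrib]
  refine Finset.sum_congr rfl fun j _ => ?_
  have := (coeff_pos hμ hp j).ne'
  rw [innov, weight, mul_inv]
  field_simp
  ring

/-- If `M_n → L`, then Toeplitz's lemma gives the order of the compensator of the walk. If moreover
`∑ D_j / W_{j+2}` converges, then by Kronecker's lemma `∑_{j<n} D_j` is negligible. -/
theorem isLittleO_sum_steps_sub (hW : Tendsto (fun n => weightSum p μ (n + 2)) atTop atTop)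
    {C : ℝ} (hC : ∀ᶠ n in atTop, weightSum p μ (n + 2) ≤ C * weightSum p μ n)
    {X : ℕ → ℝ} {L L' : ℝ}
    (hM : Tendsto (fun n => coeff p μ n * ∑ k ∈ Finset.Icc 1 n, X k * μ k) atTop (𝓝 L))
    (hK : Tendsto (fun n => ∑ j ∈ Finset.range n, (weightSum p μ (j + 2))⁻¹ * innov p μ X j)
      atTop (𝓝 L')) :
    (fun n => ∑ k ∈ Finset.Icc 1 n, X k - p * L * weightSum p μ n) =o[atTop] weightSum p μ := by
  have hmono : Monotone fun n => weightSum p μ (n + 2) := fun m n h =>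
    weightSum_mono hμ hp (by omega)
  have h1 : (fun n => ∑ j ∈ Finset.range n, innov p μ X j) =o[atTop] weightSum p μ := by
    have h := isLittleO_sum_mul_of_tendsto hmono hW hK
    have hO : (fun n => weightSum p μ (n + 2)) =O[atTop] weightSum p μ := by
      refine IsBigO.of_bound C ?_
      filter_upwards [hC] with n hn
      rwa [Real.norm_of_nonneg (weightSum_nonneg hμ hp _),
        Real.norm_of_nonneg (weightSum_nonneg hμ hp _)]
    refine (h.trans_isBigO hO).congr_left fun n => Finset.sum_congr rfl fun j _ => ?_
    rw [mul_inv_cancel_left₀ (weightSum_pos hμ hp j).ne']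
  have h2 := isLittleO_sum_mul_sub (weight_nonneg hμ hp) ((tendsto_add_atTop_iff_nat 2).1 hW) hM
  refine (h1.add (h2.const_mul_left p)).congr_left fun n => ?_
  rw [sum_steps_eq hμ hp]
  simp only [mul_sub, Finset.sum_sub_distrib, weightSum, ← Finset.sum_mul]
  ring

theorem abs_sum_steps_le {X : ℕ → ℝ} {R R' : ℝ}
    (hM : ∀ n, |coeff p μ n * ∑ k ∈ Finset.Icc 1 n, X k * μ k| ≤ R)
    (hK : ∀ n, |∑ j ∈ Finset.range n, (weightSum p μ (j + 2))⁻¹ * innov p μ X j| ≤ R') (n : ℕ) :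
    |∑ k ∈ Finset.Icc 1 n, X k| ≤ weightSum p μ (n + 2) * (2 * R' + p * R) := by
  have hmono : Monotone fun n => weightSum p μ (n + 2) := fun m n h =>
    weightSum_mono hμ hp (by omega)
  have h1 := abs_sum_mul_le hmono (weightSum_nonneg hμ hp _) hK n
  simp only [mul_inv_cancel_left₀ (weightSum_pos hμ hp _).ne'] at h1
  have h2 : |∑ j ∈ Finset.range n, weight p μ j *
      (coeff p μ j * ∑ k ∈ Finset.Icc 1 j, X k * μ k)| ≤ weightSum p μ n * R := by
    rw [weightSum, Finset.sum_mul]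
    refine (Finset.abs_sum_le_sum_abs _ _).trans (Finset.sum_le_sum fun j _ => ?_)
    have := weight_nonneg hμ hp j
    rw [abs_mul, abs_of_nonneg this]
    gcongr
    exact hM j
  have hR0 : 0 ≤ R := (abs_nonneg _).trans (hM 0)
  have h3 : weightSum p μ n * R ≤ weightSum p μ (n + 2) * R :=
    mul_le_mul_of_nonneg_right (weightSum_mono hμ hp (by omega)) hR0
  rw [sum_steps_eq hμ hp]
  refine (abs_add_le _ _).trans ?_
  rw [abs_mul, abs_of_nonneg hp]
  have h4 := mul_le_mul_of_nonneg_left (h2.trans h3) hp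
  linarith

end RVSRRW

/-! ### Square integrable martingales -/

/-- A pathwise form of Doob's `L²` inequality. -/
theorem sq_partialSups_le {s : ℕ → ℝ} (h0 : s 0 = 0) (n : ℕ) :
    partialSups s n ^ 2 ≤
      4 * s n ^ 2 - 4 * ∑ k ∈ Finset.range n, partialSups s k * (s (k + 1) - s k) := by
  have key : partialSups s n ^ 2 ≤ 2 * partialSups s n * s n -
      2 * ∑ k ∈ Finset.range n, partialSups s k * (s (k + 1) - s k) := by
    induction n with
    | zero => simp [h0]
    | succ n ih =>
      rw [Finset.sum_range_succ, partialSups_add_one]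
      rcases le_total (s (n + 1)) (partialSups s n) with h | h
      · rw [sup_eq_left.2 h]
        linarith
      · rw [sup_eq_right.2 h]
        nlinarith [sq_nonneg (s (n + 1) - partialSups s n)]
  nlinarith [sq_nonneg (partialSups s n - 2 * s n)]

section SquareIntegrable

variable {Ω : Type*} [m0 : MeasurableSpace Ω] {P : Measure Ω} [IsProbabilityMeasure P]
  {ℱ : Filtration ℕ m0} {D : ℕ → Ω → ℝ}

theorem integral_mul_eq_zero_of_condExp_eq_zero {m : MeasurableSpace Ω} (hm : m ≤ m0)
    {f g : Ω → ℝ} (hf : StronglyMeasurable[m] f) (hf2 : MemLp f 2 P) (hg2 : MemLp g 2 P)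
    (hg : P[g | m] =ᵐ[P] 0) : ∫ ω, f ω * g ω ∂P = 0 := by
  have hfg : Integrable (f * g) P := hf2.integrable_mul hg2
  have h := condExp_mul_of_stronglyMeasurable_left hf hfg (hg2.integrable (by norm_num))
  calc ∫ ω, f ω * g ω ∂P = ∫ ω, (P[f * g | m]) ω ∂P := (integral_condExp hm).symm
    _ = ∫ _, (0 : ℝ) ∂P := by
        refine integral_congr_ae ?_
        filter_upwards [h, hg] with ω h1 h2
        rw [h1, Pi.mul_apply, h2]
        simp
    _ = 0 := by simp

section Differences

variable (hDm : ∀ j, StronglyMeasurable[ℱ (j + 1)] (D j)) (hD2 : ∀ j, MemLp (D j) 2 P)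
  (hD0 : ∀ j, P[D j | ℱ j] =ᵐ[P] 0)
include hDm

theorem stronglyMeasurable_sum_differences (n : ℕ) :
    StronglyMeasurable[ℱ n] (fun ω => ∑ j ∈ Finset.range n, D j ω) := by
  refine Finset.stronglyMeasurable_fun_sum (m := ℱ n) _ fun j hj => (hDm j).mono (ℱ.mono ?_)
  have := Finset.mem_range.1 hj
  omega

include hD2 hD0

omit hDm hD0 [IsProbabilityMeasure P] in
theorem memLp_sum_differences (n : ℕ) : MemLp (fun ω => ∑ j ∈ Finset.range n, D j ω) 2 P :=
  memLp_finsetSum _ fun j _ => hD2 j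

omit hDm hD0 [IsProbabilityMeasure P] in
theorem memLp_partialSups_sum_differences (n : ℕ) :
    MemLp (fun ω => partialSups (fun k => |∑ j ∈ Finset.range k, D j ω|) n) 2 P := by
  induction n with
  | zero => simp
  | succ n ih =>
    have : (fun ω => partialSups (fun k => |∑ j ∈ Finset.range k, D j ω|) (n + 1)) =
        (fun ω => partialSups (fun k => |∑ j ∈ Finset.range k, D j ω|) n) ⊔
          fun ω => ‖∑ j ∈ Finset.range (n + 1), D j ω‖ := by
      ext ω; simp [partialSups_add_one]
    rw [this]
    exact ih.sup (memLp_sum_differences hD2 (n + 1)).norm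

theorem integral_sq_sum_differences (n : ℕ) :
    ∫ ω, (∑ j ∈ Finset.range n, D j ω) ^ 2 ∂P = ∑ j ∈ Finset.range n, ∫ ω, D j ω ^ 2 ∂P := by
  induction n with
  | zero => simp
  | succ n ih =>
    rw [Finset.sum_range_succ, ← ih]
    have h1 := integral_mul_eq_zero_of_condExp_eq_zero (ℱ.le n)
      (stronglyMeasurable_sum_differences hDm n) (memLp_sum_differences hD2 n) (hD2 n) (hD0 n)
    have i1 := (memLp_sum_differences hD2 n).integrable_sq
    have i2 : Integrable (fun ω => (∑ j ∈ Finset.range n, D j ω) * D n ω) P :=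
      (memLp_sum_differences hD2 n).integrable_mul (hD2 n)
    have i3 := (hD2 n).integrable_sq
    calc ∫ ω, (∑ j ∈ Finset.range (n + 1), D j ω) ^ 2 ∂P
        = ∫ ω, ((∑ j ∈ Finset.range n, D j ω) ^ 2 +
            2 * ((∑ j ∈ Finset.range n, D j ω) * D n ω)) + D n ω ^ 2 ∂P := by
          refine integral_congr_ae (Eventually.of_forall fun ω => ?_)
          simp only [Finset.sum_range_succ]
          ring
      _ = _ := by
          have i12 : Integrable (fun ω => (∑ j ∈ Finset.range n, D j ω) ^ 2 +
            2 * ((∑ j ∈ Finset.range n, D j ω) * D n ω)) P := i1.add (i2.const_mul 2)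
          rw [integral_add i12 i3, integral_add i1 (i2.const_mul 2),
            integral_const_mul, h1]
          ring

/-- **Doob's `L²` inequality** for a martingale started at `0`, in terms of its differences. -/
theorem integral_sq_partialSups_le (n : ℕ) :
    ∫ ω, partialSups (fun k => |∑ j ∈ Finset.range k, D j ω|) n ^ 2 ∂P ≤
      4 * ∑ j ∈ Finset.range n, ∫ ω, D j ω ^ 2 ∂P := by
  let K : ℕ → Ω → ℝ := fun n ω => ∑ j ∈ Finset.range n, D j ω
  let m : ℕ → Ω → ℝ := fun n ω => partialSups (fun k => |K k ω|) n
  let sg : ℝ → ℝ := fun x => if 0 ≤ x then 1 else -1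
  have hsg : Measurable sg := Measurable.ite measurableSet_Ici measurable_const measurable_const
  have hsg1 : ∀ x, ‖sg x‖ ≤ 1 := fun x => by simp only [sg]; split_ifs <;> simp
  have hsgle : ∀ x y : ℝ, sg x * y ≤ |x + y| - |x| := by
    intro x y
    simp only [sg]
    split_ifs with h
    · rw [abs_of_nonneg h]
      have := le_abs_self (x + y)
      linarith
    · rw [abs_of_neg (not_le.1 h)]
      have := neg_abs_le (x + y)
      linarith
  have hKm := stronglyMeasurable_sum_differences hDm
  have hK2 := memLp_sum_differences hD2
  have hmm : ∀ n, StronglyMeasurable[ℱ n] (m n) := by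
    intro n
    induction n with
    | zero => simpa [m, K] using stronglyMeasurable_const
    | succ n ih =>
      have : m (n + 1) = m n ⊔ fun ω => ‖K (n + 1) ω‖ := by
        ext ω; simp [m, partialSups_add_one]
      rw [this]
      exact @StronglyMeasurable.sup _ _ _ _ (ℱ (n + 1)) _ _ _ (ih.mono (ℱ.mono n.le_succ))
        (hKm (n + 1)).norm
  have hm2 : ∀ n, MemLp (m n) 2 P := memLp_partialSups_sum_differences hD2
  have hGm : ∀ k, StronglyMeasurable[ℱ k] fun ω => m k ω * sg (K k ω) := fun k =>
    (hmm k).mul (hsg.comp (hKm k).measurable).stronglyMeasurable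
  have hG2 : ∀ k, MemLp (fun ω => m k ω * sg (K k ω)) 2 P := fun k =>
    MemLp.of_le (hm2 k) ((hGm k).mono (ℱ.le k)).aestronglyMeasurable
      (Eventually.of_forall fun ω => by
        rw [norm_mul]
        exact mul_le_of_le_one_right (norm_nonneg _) (hsg1 _))
  have hm0 : ∀ k ω, 0 ≤ m k ω := fun k ω =>
    (abs_nonneg _).trans (le_partialSups (fun k => |K k ω|) k)
  have hpath : ∀ ω, m n ω ^ 2 ≤ 4 * K n ω ^ 2 -
      4 * ∑ k ∈ Finset.range n, m k ω * sg (K k ω) * D k ω := by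
    intro ω
    refine (sq_partialSups_le (s := fun k => |K k ω|)
      (by simp [K]) n).trans ?_
    rw [sq_abs]
    refine sub_le_sub_left (mul_le_mul_of_nonneg_left (Finset.sum_le_sum fun k _ => ?_)
      (by norm_num)) _
    rw [mul_assoc]
    refine mul_le_mul_of_nonneg_left ?_ (hm0 k ω)
    simpa only [K, Finset.sum_range_succ] using hsgle (K k ω) (D k ω)
  have hi : ∀ k, Integrable (fun ω => m k ω * sg (K k ω) * D k ω) P := fun k =>
    (hG2 k).integrable_mul (hD2 k)
  have hint := integral_mono (hm2 n).integrable_sq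
    (((hK2 n).integrable_sq.const_mul 4).sub
      ((integrable_finsetSum (Finset.range n) fun k _ => hi k).const_mul 4)) hpath
  have hzero : ∑ k ∈ Finset.range n, ∫ ω, m k ω * sg (K k ω) * D k ω ∂P = 0 :=
    Finset.sum_eq_zero fun k _ =>
      integral_mul_eq_zero_of_condExp_eq_zero (ℱ.le k) (hGm k) (hG2 k) (hD2 k) (hD0 k)
  refine hint.trans (le_of_eq ?_)
  simp only [Pi.sub_apply]
  rw [integral_sub ((hK2 n).integrable_sq.const_mul 4)
      ((integrable_finsetSum (Finset.range n) fun k _ => hi k).const_mul 4),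
    integral_const_mul, integral_const_mul, integral_finsetSum _ fun k _ => hi k,
    integral_sq_sum_differences hDm hD2 hD0, hzero, mul_zero, sub_zero]

variable (hsum : Summable fun j => ∫ ω, D j ω ^ 2 ∂P)
include hsum

/-- The maximal function of an `L²`-bounded martingale is square integrable. -/
theorem lintegral_iSup_sq_lt_top :
    ∫⁻ ω, (⨆ n, ‖∑ j ∈ Finset.range n, D j ω‖ₑ) ^ 2 ∂P < ∞ := by
  let m : ℕ → Ω → ℝ := fun n ω => partialSups (fun k => |∑ j ∈ Finset.range k, D j ω|) n
  have hm2 : ∀ n, MemLp (m n) 2 P := memLp_partialSups_sum_differences hD2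
  have hm0 : ∀ k ω, 0 ≤ m k ω := fun k ω =>
    (abs_nonneg _).trans (le_partialSups (fun k => |∑ j ∈ Finset.range k, D j ω|) k)
  have hle : ∀ ω, (⨆ n, ‖∑ j ∈ Finset.range n, D j ω‖ₑ) ^ 2 ≤ ⨆ n, ENNReal.ofReal (m n ω ^ 2) := by
    intro ω
    rw [ENNReal.iSup_pow]
    refine iSup_mono fun n => ?_
    rw [Real.enorm_eq_ofReal_abs, ← ENNReal.ofReal_pow (abs_nonneg _)]
    exact ENNReal.ofReal_le_ofReal (pow_le_pow_left₀ (abs_nonneg _)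
      (le_partialSups (fun k => |∑ j ∈ Finset.range k, D j ω|) n) 2)
  refine (lintegral_mono hle).trans_lt ?_
  rw [lintegral_iSup' (fun n => (hm2 n).integrable_sq.aemeasurable.ennreal_ofReal)
    (Eventually.of_forall fun ω i j hij => ENNReal.ofReal_le_ofReal
      (pow_le_pow_left₀ (hm0 i ω) ((partialSups _).mono hij) 2))]
  refine (iSup_le fun n => ?_ : _ ≤ ENNReal.ofReal (4 * ∑' j, ∫ ω, D j ω ^ 2 ∂P)).trans_lt
    ENNReal.ofReal_lt_top
  rw [← ofReal_integral_eq_lintegral_ofReal (hm2 n).integrable_sq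
    (Eventually.of_forall fun ω => sq_nonneg _)]
  refine ENNReal.ofReal_le_ofReal ((integral_sq_partialSups_le hDm hD2 hD0 n).trans ?_)
  gcongr
  exact hsum.sum_le_tsum _ fun j _ => integral_nonneg fun ω => sq_nonneg _

/-- Almost sure convergence of martingales with square summable differences. -/
theorem exists_tendsto_sum_differences :
    ∃ L : Ω → ℝ, Measurable L ∧
      ∀ᵐ ω ∂P, Tendsto (fun n => ∑ j ∈ Finset.range n, D j ω) atTop (𝓝 (L ω)) := by
  let K : ℕ → Ω → ℝ := fun n ω => ∑ j ∈ Finset.range n, D j ω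
  have hKm := stronglyMeasurable_sum_differences hDm
  have hmart : Martingale K ℱ P := by
    refine martingale_of_condExp_sub_eq_zero_nat hKm
      (fun n => (memLp_sum_differences hD2 n).integrable (by norm_num)) fun n => ?_
    have : K (n + 1) - K n = D n := by
      ext ω; simp [K, Finset.sum_range_succ]
    rw [this]
    exact hD0 n
  let I := ∫⁻ ω, (⨆ n, ‖∑ j ∈ Finset.range n, D j ω‖ₑ) ^ 2 ∂P
  have hI : I < ∞ := lintegral_iSup_sq_lt_top hDm hD2 hD0 hsum
  have hbdd : ∀ n, eLpNorm (K n) 1 P ≤ ((1 + I).toNNReal : ℝ≥0) := by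
    intro n
    rw [ENNReal.coe_toNNReal (by simp [hI.ne]), eLpNorm_one_eq_lintegral_enorm]
    calc ∫⁻ ω, ‖K n ω‖ₑ ∂P
        ≤ ∫⁻ ω, 1 + (⨆ n, ‖∑ j ∈ Finset.range n, D j ω‖ₑ) ^ 2 ∂P := by
          refine lintegral_mono fun ω => ?_
          have h1 : ‖K n ω‖ₑ ≤ ⨆ n, ‖∑ j ∈ Finset.range n, D j ω‖ₑ :=
            le_iSup (fun n => ‖∑ j ∈ Finset.range n, D j ω‖ₑ) n
          refine h1.trans ?_
          rcases le_total (⨆ n, ‖∑ j ∈ Finset.range n, D j ω‖ₑ) 1 with h | h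
          · exact h.trans le_self_add
          · exact le_add_left (le_self_pow h two_ne_zero)
      _ = 1 + I := by rw [lintegral_add_left measurable_const]; simp [I]
  exact ⟨_, Filtration.stronglyMeasurable_limit_process'.measurable,
    hmart.submartingale.ae_tendsto_limitProcess hbdd⟩

end Differences

end SquareIntegrable

/-! ### Independence of the inputs -/

/-- Two mutually independent families of `σ`-algebras that are independent of each other form
together a mutually independent family. -/
theorem iIndep_sumElim {Ω ι κ : Type*} {m0 : MeasurableSpace Ω} {P : Measure Ω}
    {m₁ : ι → MeasurableSpace Ω} {m₂ : κ → MeasurableSpace Ω} (h₁ : iIndep m₁ P) (h₂ : iIndep m₂ P)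
    (h : Indep (⨆ i, m₁ i) (⨆ i, m₂ i) P) : iIndep (Sum.elim m₁ m₂) P := by
  classical
  rw [iIndep_iff]
  intro S f hf
  have hl : ∀ i, i ∈ S.toLeft → MeasurableSet[m₁ i] (f (Sum.inl i)) := fun i hi =>
    hf (Sum.inl i) (Finset.mem_toLeft.1 hi)
  have hr : ∀ i, i ∈ S.toRight → MeasurableSet[m₂ i] (f (Sum.inr i)) := fun i hi =>
    hf (Sum.inr i) (Finset.mem_toRight.1 hi)
  have hinter : ⋂ i ∈ S, f i =
      (⋂ i ∈ S.toLeft, f (Sum.inl i)) ∩ ⋂ i ∈ S.toRight, f (Sum.inr i) := by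
    ext ω
    simp only [mem_iInter, mem_inter_iff, Finset.mem_toLeft, Finset.mem_toRight, Sum.forall]
  have hml : MeasurableSet[⨆ i, m₁ i] (⋂ i ∈ S.toLeft, f (Sum.inl i)) :=
    MeasurableSet.biInter S.toLeft.countable_toSet fun i hi => le_iSup m₁ i _ (hl i hi)
  have hmr : MeasurableSet[⨆ i, m₂ i] (⋂ i ∈ S.toRight, f (Sum.inr i)) :=
    MeasurableSet.biInter S.toRight.countable_toSet fun i hi => le_iSup m₂ i _ (hr i hi)
  rw [hinter, (Indep_iff _ _ _).1 h _ _ hml hmr, h₁.meas_biInter hl, h₂.meas_biInter hr,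
    Finset.prod_sum_eq_prod_toLeft_mul_prod_toRight]

namespace RVSRRW

variable {Ω : Type*} [m0 : MeasurableSpace Ω] {P : Measure Ω} [IsProbabilityMeasure P]
  {γ p : ℝ} {μ : ℕ → ℝ} {ξ α : ℕ → Ω → ℝ} {β : ℕ → Ω → ℕ}

/-- The `σ`-algebras generated by the individual inputs `ξ_{j+1}`, `α_{j+2}`, `β_{j+2}`. -/
@[reducible] def inputAlgebra (ξ α : ℕ → Ω → ℝ) (β : ℕ → Ω → ℕ) : ℕ ⊕ (ℕ ⊕ ℕ) → MeasurableSpace Ω :=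
  Sum.elim (fun j => MeasurableSpace.comap (ξ (j + 1)) inferInstance)
    (Sum.elim (fun j => MeasurableSpace.comap (α (j + 2)) inferInstance)
      (fun j => MeasurableSpace.comap (β (j + 2)) inferInstance))

/-- The labels of the inputs with index at most `n`. -/
def past (n : ℕ) : Set (ℕ ⊕ (ℕ ⊕ ℕ)) :=
  {i | Sum.elim (fun j => j + 1 ≤ n) (Sum.elim (fun j => j + 2 ≤ n) (fun j => j + 2 ≤ n)) i}

theorem past_mono : Monotone past := by
  rintro m n h (i | i | i) hi
  all_goals
    simp only [past, mem_ofPred_eq, Sum.elim_inl, Sum.elim_inr] at hi ⊢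
    omega

/-- The labels of the inputs with index `m + 2`. -/
def present (m : ℕ) : Set (ℕ ⊕ (ℕ ⊕ ℕ)) :=
  {Sum.inl (m + 1), Sum.inr (Sum.inl m), Sum.inr (Sum.inr m)}

theorem disjoint_present_past (m : ℕ) : Disjoint (present m) (past (m + 1)) := by
  rw [Set.disjoint_left]
  rintro i (rfl | rfl | rfl) hi <;>
    simp only [past, mem_ofPred_eq, Sum.elim_inl, Sum.elim_inr] at hi <;> omega

theorem step_zero (x a : ℕ → ℝ) (b : ℕ → ℕ) : step x a b 0 = 0 := by rw [step]

theorem step_one (x a : ℕ → ℝ) (b : ℕ → ℕ) : step x a b 1 = x 1 := by rw [step]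

theorem step_add_two (x a : ℕ → ℝ) (b : ℕ → ℕ) (m : ℕ) :
    step x a b (m + 2) =
      a (m + 2) * ∑ k ∈ Finset.Icc 1 (m + 1), (if b (m + 2) = k then step x a b k else 0) +
        (1 - a (m + 2)) * x (m + 2) := by
  rw [step, Finset.sum_ite_eq]
  congr 2
  by_cases h : b (m + 2) < m + 2
  · rcases Nat.eq_zero_or_pos (b (m + 2)) with h0 | h0
    · simp [h0, step_zero]
    · rw [dif_pos h, if_pos (Finset.mem_Icc.2 ⟨h0, by omega⟩)]
  · rw [dif_neg h, if_neg fun h' => h (by have := (Finset.mem_Icc.1 h').2; omega)]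

namespace IsInput

variable (h : IsInput P p μ ξ α β)
include h

omit [IsProbabilityMeasure P] in
theorem inputAlgebra_le (i : ℕ ⊕ (ℕ ⊕ ℕ)) : inputAlgebra ξ α β i ≤ m0 := by
  rcases i with j | j | j
  · exact (h.measurable_innovation (j + 1) (by omega)).comap_le
  · exact (h.measurable_indicator (j + 2) (by omega)).comap_le
  · exact (h.measurable_memory (j + 2) (by omega)).comap_le

omit [IsProbabilityMeasure P] in
theorem iIndep_inputAlgebra : iIndep (inputAlgebra ξ α β) P := by
  refine iIndep_sumElim h.indep_innovation.iIndep (iIndep_sumElim h.indep_indicator.iIndep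
    h.indep_memory.iIndep ?_) ?_
  · have := (IndepFun_iff_Indep _ _ _).1 h.indep_indicator_memory
    rwa [MeasurableSpace.comap_process_pi, MeasurableSpace.comap_process_pi] at this
  · have h1 := (IndepFun_iff_Indep _ _ _).1 h.indep_innovation_choices
    rw [MeasurableSpace.comap_process_pi] at h1
    refine indep_of_indep_of_le_right h1 ?_
    rw [iSup_le_iff]
    rintro (j | j)
    · have : α (j + 2) = (fun q : (ℕ → ℝ) × (ℕ → ℕ) => q.1 j) ∘
          fun ω => ((fun n => α (n + 2) ω), (fun n => β (n + 2) ω)) := rfl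
      rw [Sum.elim_inl, this, ← MeasurableSpace.comap_comp]
      exact MeasurableSpace.comap_mono ((measurable_pi_apply j).comp measurable_fst).comap_le
    · have : β (j + 2) = (fun q : (ℕ → ℝ) × (ℕ → ℕ) => q.2 j) ∘
          fun ω => ((fun n => α (n + 2) ω), (fun n => β (n + 2) ω)) := rfl
      rw [Sum.elim_inr, this, ← MeasurableSpace.comap_comp]
      exact MeasurableSpace.comap_mono ((measurable_pi_apply j).comp measurable_snd).comap_le

/-- The filtration generated by the inputs. -/
def filtration : Filtration ℕ m0 where
  seq n := ⨆ i ∈ past n, inputAlgebra ξ α β i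
  mono' _ _ hmn := biSup_mono fun _ hi => past_mono hmn hi
  le' _ := iSup₂_le fun i _ => h.inputAlgebra_le i

/-- The `σ`-algebra generated by `ξ_{m+2}`, `α_{m+2}` and `β_{m+2}`. -/
@[reducible] def presentAlgebra (_ : IsInput P p μ ξ α β) (m : ℕ) : MeasurableSpace Ω :=
  ⨆ i ∈ present m, inputAlgebra ξ α β i

omit [IsProbabilityMeasure P] in
theorem presentAlgebra_le (m : ℕ) : h.presentAlgebra m ≤ m0 :=
  iSup₂_le fun i _ => h.inputAlgebra_le i

omit [IsProbabilityMeasure P] in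
theorem indep_present_past (m : ℕ) : Indep (h.presentAlgebra m) (h.filtration (m + 1)) P :=
  indep_iSup_of_disjoint h.inputAlgebra_le h.iIndep_inputAlgebra (disjoint_present_past m)

section Measurability

omit [IsProbabilityMeasure P]

theorem measurable_filtration_innovation {n j : ℕ} (hj : j + 1 ≤ n) :
    Measurable[h.filtration n] (ξ (j + 1)) :=
  measurable_iff_comap_le.2 <| le_iSup₂_of_le (f := fun i (_ : i ∈ past n) => inputAlgebra ξ α β i)
    (Sum.inl j) hj le_rfl

theorem measurable_filtration_indicator {n j : ℕ} (hj : j + 2 ≤ n) :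
    Measurable[h.filtration n] (α (j + 2)) :=
  measurable_iff_comap_le.2 <| le_iSup₂_of_le (f := fun i (_ : i ∈ past n) => inputAlgebra ξ α β i)
    (Sum.inr (Sum.inl j)) hj le_rfl

theorem measurable_filtration_memory {n j : ℕ} (hj : j + 2 ≤ n) :
    Measurable[h.filtration n] (β (j + 2)) :=
  measurable_iff_comap_le.2 <| le_iSup₂_of_le (f := fun i (_ : i ∈ past n) => inputAlgebra ξ α β i)
    (Sum.inr (Sum.inr j)) hj le_rfl

theorem measurable_present_innovation (m : ℕ) : Measurable[h.presentAlgebra m] (ξ (m + 2)) :=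
  measurable_iff_comap_le.2 <| le_iSup₂_of_le
    (f := fun i (_ : i ∈ present m) => inputAlgebra ξ α β i) (Sum.inl (m + 1)) (by simp [present])
    le_rfl

theorem measurable_present_indicator (m : ℕ) : Measurable[h.presentAlgebra m] (α (m + 2)) :=
  measurable_iff_comap_le.2 <| le_iSup₂_of_le
    (f := fun i (_ : i ∈ present m) => inputAlgebra ξ α β i) (Sum.inr (Sum.inl m))
    (by simp [present]) le_rfl

theorem measurable_present_memory (m : ℕ) : Measurable[h.presentAlgebra m] (β (m + 2)) :=
  measurable_iff_comap_le.2 <| le_iSup₂_of_le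
    (f := fun i (_ : i ∈ present m) => inputAlgebra ξ α β i) (Sum.inr (Sum.inr m))
    (by simp [present]) le_rfl

theorem measurable_filtration_step {k n : ℕ} (hkn : k ≤ n) :
    Measurable[h.filtration n]
      (fun ω => step (fun k => ξ k ω) (fun k => α k ω) (fun k => β k ω) k) := by
  induction k using Nat.strong_induction_on with
  | _ k ih =>
    match k with
    | 0 => simp only [step_zero]; exact measurable_const
    | 1 => simp only [step_one]; exact h.measurable_filtration_innovation hkn
    | m + 2 =>
      simp only [step_add_two]
      refine ((h.measurable_filtration_indicator hkn).mul
        (Finset.measurable_fun_sum (m := h.filtration n) _ fun k hk => ?_)).add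
        ((measurable_const.sub (h.measurable_filtration_indicator hkn)).mul
        (h.measurable_filtration_innovation (j := m + 1) hkn))
      have hk' := (Finset.mem_Icc.1 hk).2
      exact Measurable.ite (h.measurable_filtration_memory hkn (measurableSet_singleton k))
        (ih k (by omega) (by omega)) measurable_const

end Measurability

end IsInput

end RVSRRW

/-! ### The martingale differences of the walk -/

namespace RVSRRW

variable {Ω : Type*} [m0 : MeasurableSpace Ω] {P : Measure Ω} [IsProbabilityMeasure P]
  {γ p : ℝ} {μ : ℕ → ℝ} {ξ α : ℕ → Ω → ℝ} {β : ℕ → Ω → ℕ}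

/-- The sequence of steps at the outcome `ω`. -/
abbrev steps (ξ α : ℕ → Ω → ℝ) (β : ℕ → Ω → ℕ) (ω : Ω) : ℕ → ℝ :=
  step (fun k => ξ k ω) (fun k => α k ω) (fun k => β k ω)

namespace IsInput

variable (h : IsInput P p μ ξ α β)
include h

theorem ae_indicator (m : ℕ) : ∀ᵐ ω ∂P, α (m + 2) ω = 1 ∨ α (m + 2) ω = 0 := by
  obtain ⟨h1, h0⟩ := h.law_indicator (m + 2) (by omega)
  have hα := h.measurable_indicator (m + 2) (by omega)
  have hm : MeasurableSet {ω | α (m + 2) ω = 0} := hα (measurableSet_singleton 0)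
  have hm1 : MeasurableSet {ω | α (m + 2) ω = 1} := hα (measurableSet_singleton 1)
  have hd : Disjoint {ω | α (m + 2) ω = 1} {ω | α (m + 2) ω = 0} := by
    rw [Set.disjoint_left]
    intro ω h1 h0
    simp only [mem_ofPred_eq] at h1 h0
    linarith
  have hU : P.real ({ω | α (m + 2) ω = 1} ∪ {ω | α (m + 2) ω = 0}) = 1 := by
    rw [measureReal_union hd hm, h1, h0]
    ring
  have hU' : P ({ω | α (m + 2) ω = 1} ∪ {ω | α (m + 2) ω = 0}) = 1 := by
    rwa [measureReal_def, ENNReal.toReal_eq_one_iff] at hU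
  exact (mem_ae_iff_prob_eq_one (hm1.union hm)).2 hU'

theorem ae_norm_indicator_le (m : ℕ) : ∀ᵐ ω ∂P, ‖α (m + 2) ω‖ ≤ 1 := by
  filter_upwards [h.ae_indicator m] with ω hω
  rcases hω with hω | hω <;> simp [hω]

theorem integrable_indicator (m : ℕ) : Integrable (α (m + 2)) P :=
  Integrable.of_bound (h.measurable_indicator (m + 2) (by omega)).aestronglyMeasurable 1
    (h.ae_norm_indicator_le m)

theorem integral_indicator (m : ℕ) : ∫ ω, α (m + 2) ω ∂P = p := by
  have hm1 : MeasurableSet {ω | α (m + 2) ω = 1} :=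
    h.measurable_indicator (m + 2) (by omega) (measurableSet_singleton 1)
  rw [← (h.law_indicator (m + 2) (by omega)).1, ← integral_indicator_one hm1]
  refine integral_congr_ae ?_
  filter_upwards [h.ae_indicator m] with ω hω
  rcases hω with hω | hω <;> simp [Set.indicator, hω]

theorem integral_recall (m k : ℕ) (hk1 : 1 ≤ k) (hk : k ≤ m + 1) :
    ∫ ω, α (m + 2) ω * (if β (m + 2) ω = k then 1 else 0) ∂P = p * (μ k / nu μ (m + 1)) := by
  have hi : Indep (inputAlgebra ξ α β (Sum.inr (Sum.inl m)))
      (inputAlgebra ξ α β (Sum.inr (Sum.inr m))) P := h.iIndep_inputAlgebra.indep (by simp)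
  have hαβ : IndepFun (α (m + 2)) (β (m + 2)) P := (IndepFun_iff_Indep _ _ _).2 hi
  have hφ : Measurable fun b : ℕ => if b = k then (1 : ℝ) else 0 := measurable_from_nat
  have hβ := h.measurable_memory (m + 2) (by omega)
  have hind : IndepFun (α (m + 2)) (fun ω => if β (m + 2) ω = k then (1 : ℝ) else 0) P :=
    hαβ.comp measurable_id hφ
  rw [hind.integral_fun_mul_eq_mul_integral (h.integrable_indicator m).aestronglyMeasurable
    (hφ.comp hβ).aestronglyMeasurable, h.integral_indicator]
  have hmk : MeasurableSet {ω | β (m + 2) ω = k} := hβ (measurableSet_singleton k)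
  have := h.law_memory (m + 2) (by omega) k hk1 (by omega)
  rw [show m + 2 - 1 = m + 1 by omega] at this
  rw [← this, ← integral_indicator_one hmk]
  congr 2
  ext ω
  simp [Set.indicator]

variable (hvar : ∫ ω, ξ 1 ω ^ 2 ∂P = 1)

omit [IsProbabilityMeasure P] in
theorem integral_innovation (n : ℕ) : ∫ ω, ξ (n + 1) ω ∂P = 0 := by
  rw [(h.identDistrib_innovation (n + 1) (by omega)).integral_eq, h.mean_innovation]

omit [IsProbabilityMeasure P] in
theorem indepFun_indicator_innovation (m : ℕ) : IndepFun (α (m + 2)) (ξ (m + 2)) P :=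
  (IndepFun_iff_Indep _ _ _).2 (h.iIndep_inputAlgebra.indep
    (show (Sum.inr (Sum.inl m) : ℕ ⊕ (ℕ ⊕ ℕ)) ≠ Sum.inl (m + 1) by simp))

omit [IsProbabilityMeasure P] in
theorem integral_fresh (m : ℕ) : ∫ ω, (1 - α (m + 2) ω) * ξ (m + 2) ω ∂P = 0 := by
  have hind : IndepFun (fun ω => 1 - α (m + 2) ω) (ξ (m + 2)) P :=
    (h.indepFun_indicator_innovation m).comp (measurable_const.sub measurable_id) measurable_id
  rw [hind.integral_fun_mul_eq_mul_integral
    (measurable_const.sub (h.measurable_indicator (m + 2) (by omega))).aestronglyMeasurable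
    (h.measurable_innovation (m + 2) (by omega)).aestronglyMeasurable,
    h.integral_innovation (m + 1), mul_zero]

include hvar

omit [IsProbabilityMeasure P] in
theorem memLp_innovation (n : ℕ) : MemLp (ξ (n + 1)) 2 P := by
  rw [(h.identDistrib_innovation (n + 1) (by omega)).memLp_iff,
    memLp_two_iff_integrable_sq (h.measurable_innovation 1 le_rfl).aestronglyMeasurable]
  exact integrable_of_integral_eq_one hvar

omit [IsProbabilityMeasure P] in
theorem integral_innovation_sq (n : ℕ) : ∫ ω, ξ (n + 1) ω ^ 2 ∂P = 1 := by
  rw [← hvar]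
  exact (h.identDistrib_innovation (n + 1) (by omega)).sq.integral_eq

theorem integral_fresh_sq (m : ℕ) :
    ∫ ω, (1 - α (m + 2) ω) * ξ (m + 2) ω ^ 2 ∂P = 1 - p := by
  have hind : IndepFun (fun ω => 1 - α (m + 2) ω) (fun ω => ξ (m + 2) ω ^ 2) P :=
    (h.indepFun_indicator_innovation m).comp (measurable_const.sub measurable_id)
      (measurable_id.pow_const 2)
  rw [hind.integral_fun_mul_eq_mul_integral
    (measurable_const.sub (h.measurable_indicator (m + 2) (by omega))).aestronglyMeasurable
    ((h.measurable_innovation (m + 2) (by omega)).pow_const 2).aestronglyMeasurable,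
    h.integral_innovation_sq hvar (m + 1), mul_one,
    integral_sub (integrable_const 1) (h.integrable_indicator m), h.integral_indicator]
  simp

omit hvar [IsProbabilityMeasure P] in
/-- The inputs with index `m + 2` are independent of every function of the inputs with smaller
index. -/
theorem indepFun_of_measurable {m : ℕ} {f g : Ω → ℝ} (hf : Measurable[h.presentAlgebra m] f)
    (hg : Measurable[h.filtration (m + 1)] g) : IndepFun f g P :=
  (IndepFun_iff_Indep _ _ _).2 (indep_of_indep_of_le (h.indep_present_past m)
    (measurable_iff_comap_le.1 hf) (measurable_iff_comap_le.1 hg))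

omit hvar [IsProbabilityMeasure P] in
theorem measurable_present_recall (m k : ℕ) : Measurable[h.presentAlgebra m]
    fun ω => α (m + 2) ω * (if β (m + 2) ω = k then (1 : ℝ) else 0) :=
  (h.measurable_present_indicator m).mul (Measurable.ite
    (h.measurable_present_memory m (measurableSet_singleton k)) measurable_const measurable_const)

omit hvar in
theorem ae_norm_recall_le (m k : ℕ) :
    ∀ᵐ ω ∂P, ‖α (m + 2) ω * (if β (m + 2) ω = k then (1 : ℝ) else 0)‖ ≤ 1 := by
  filter_upwards [h.ae_norm_indicator_le m] with ω hω
  split_ifs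
  · simpa using hω
  · simp

omit h hvar [IsProbabilityMeasure P] m0 in
theorem steps_add_two (m : ℕ) (ω : Ω) : steps ξ α β ω (m + 2) =
    ∑ k ∈ Finset.Icc 1 (m + 1), α (m + 2) ω * (if β (m + 2) ω = k then (1 : ℝ) else 0) *
      steps ξ α β ω k + (1 - α (m + 2) ω) * ξ (m + 2) ω := by
  rw [steps, step_add_two, Finset.mul_sum]
  congr 1
  refine Finset.sum_congr rfl fun k _ => ?_
  split_ifs <;> simp

omit hvar in
/-- The recalled and the fresh part of a step have disjoint supports, hence no cross terms. -/
theorem ae_steps_add_two_sq (m : ℕ) : ∀ᵐ ω ∂P, steps ξ α β ω (m + 2) ^ 2 =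
    ∑ k ∈ Finset.Icc 1 (m + 1), α (m + 2) ω * (if β (m + 2) ω = k then (1 : ℝ) else 0) *
      steps ξ α β ω k ^ 2 + (1 - α (m + 2) ω) * ξ (m + 2) ω ^ 2 := by
  filter_upwards [h.ae_indicator m] with ω hω
  rw [steps_add_two]
  rcases hω with hω | hω
  · simp only [hω, one_mul, sub_self, zero_mul, add_zero, ite_mul, Finset.sum_ite_eq]
    split_ifs <;> simp
  · simp [hω]

omit hvar in
theorem integrable_recall_mul {m k : ℕ} {f : Ω → ℝ} (hf : Integrable f P) :
    Integrable (fun ω => α (m + 2) ω * (if β (m + 2) ω = k then (1 : ℝ) else 0) * f ω) P :=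
  hf.bdd_mul (((h.measurable_present_recall m k).mono (h.presentAlgebra_le m)
    le_rfl).aestronglyMeasurable) (h.ae_norm_recall_le m k)

omit hvar in
theorem integrable_fresh_mul {m : ℕ} {f : Ω → ℝ} (hf : Integrable f P) :
    Integrable (fun ω => (1 - α (m + 2) ω) * f ω) P := by
  refine hf.bdd_mul (c := 1) (measurable_const.sub
    (h.measurable_indicator (m + 2) (by omega))).aestronglyMeasurable ?_
  filter_upwards [h.ae_indicator m] with ω hω
  rcases hω with hω | hω <;> simp [hω]

omit hvar [IsProbabilityMeasure P] in
theorem measurable_steps (n : ℕ) : Measurable fun ω => steps ξ α β ω n :=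
  (h.measurable_filtration_step (le_refl n)).mono (h.filtration.le n) le_rfl

/-- The steps have second moment at most `1`, by induction: a recalled step is an average of the
previous ones. -/
theorem memLp_integral_sq_steps (hμ : RegularlyVarying μ γ) (hp : 0 ≤ p) (n : ℕ) :
    MemLp (fun ω => steps ξ α β ω n) 2 P ∧ ∫ ω, steps ξ α β ω n ^ 2 ∂P ≤ 1 := by
  induction n using Nat.strong_induction_on with
  | _ n ih =>
    match n with
    | 0 => simp [steps, step_zero]
    | 1 =>
      simp only [steps, step_one]
      exact ⟨h.memLp_innovation hvar 0, (h.integral_innovation_sq hvar 0).le⟩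
    | m + 2 =>
      have hi1 : ∀ k ∈ Finset.Icc 1 (m + 1), Integrable (fun ω =>
          α (m + 2) ω * (if β (m + 2) ω = k then (1 : ℝ) else 0) * steps ξ α β ω k ^ 2) P :=
        fun k hk => h.integrable_recall_mul
          (ih k (by have := (Finset.mem_Icc.1 hk).2; omega)).1.integrable_sq
      have hi2 : Integrable (fun ω => (1 - α (m + 2) ω) * ξ (m + 2) ω ^ 2) P :=
        h.integrable_fresh_mul (h.memLp_innovation hvar (m + 1)).integrable_sq
      have hae := h.ae_steps_add_two_sq m
      refine ⟨?_, ?_⟩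
      · rw [memLp_two_iff_integrable_sq (h.measurable_steps (m + 2)).aestronglyMeasurable,
          integrable_congr hae]
        exact (integrable_finsetSum _ hi1).add hi2
      · rw [integral_congr_ae hae, integral_add (integrable_finsetSum _ hi1) hi2,
          h.integral_fresh_sq hvar, integral_finsetSum _ hi1]
        have hν := nu_pos hμ (show 1 ≤ m + 1 by omega)
        have hle : ∑ k ∈ Finset.Icc 1 (m + 1), ∫ ω, α (m + 2) ω *
            (if β (m + 2) ω = k then (1 : ℝ) else 0) * steps ξ α β ω k ^ 2 ∂P ≤
            ∑ k ∈ Finset.Icc 1 (m + 1), p * (μ k / nu μ (m + 1)) := by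
          refine Finset.sum_le_sum fun k hk => ?_
          obtain ⟨hk1, hk2⟩ := Finset.mem_Icc.1 hk
          have hind := h.indepFun_of_measurable (h.measurable_present_recall m k)
            ((h.measurable_filtration_step hk2).pow_const 2)
          rw [hind.integral_fun_mul_eq_mul_integral
            ((h.measurable_present_recall m k).mono (h.presentAlgebra_le m)
              le_rfl).aestronglyMeasurable
            ((h.measurable_steps k).pow_const 2).aestronglyMeasurable,
            h.integral_recall m k hk1 hk2]
          have := (hμ.pos hk1).le
          exact mul_le_of_le_one_right (by positivity) (ih k (by omega)).2
        rw [← Finset.mul_sum, ← Finset.sum_div,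
          show ∑ k ∈ Finset.Icc 1 (m + 1), μ k = nu μ (m + 1) from rfl, div_self hν.ne', mul_one] at hle
        linarith

omit hvar [IsProbabilityMeasure P] in
theorem stronglyMeasurable_innov (j : ℕ) :
    StronglyMeasurable[h.filtration (j + 1)] fun ω => innov p μ (steps ξ α β ω) j := by
  refine Measurable.stronglyMeasurable ?_
  refine (h.measurable_filtration_step (le_refl (j + 1))).sub
    (measurable_const.mul (Measurable.div_const
      (Finset.measurable_fun_sum (m := h.filtration (j + 1)) _ fun k hk => ?_) _))
  exact (h.measurable_filtration_step
    (by have := (Finset.mem_Icc.1 hk).2; omega)).mul measurable_const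

theorem memLp_innov (hμ : RegularlyVarying μ γ) (hp : 0 ≤ p) (j : ℕ) :
    MemLp (fun ω => innov p μ (steps ξ α β ω) j) 2 P := by
  have hX := fun k => (h.memLp_integral_sq_steps hvar hμ hp k).1
  have h1 : MemLp (fun ω => ∑ k ∈ Finset.Icc 1 j, steps ξ α β ω k * μ k) 2 P :=
    memLp_finsetSum _ fun k _ => (hX k).mul_const (μ k)
  refine (hX (j + 1)).sub ((h1.mul_const (p / nu μ j)).ae_eq (Eventually.of_forall fun ω => ?_))
  simp only
  ring

theorem integral_sq_innov_le (hμ : RegularlyVarying μ γ) (hp : 0 ≤ p) (hp1 : p ≤ 1) (j : ℕ) :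
    ∫ ω, innov p μ (steps ξ α β ω) j ^ 2 ∂P ≤ 4 := by
  have hX := h.memLp_integral_sq_steps hvar hμ hp
  have hj : ∀ ω, innov p μ (steps ξ α β ω) j ^ 2 ≤ 2 * steps ξ α β ω (j + 1) ^ 2 +
      ∑ k ∈ Finset.Icc 1 j, 2 * (μ k / nu μ j) * steps ξ α β ω k ^ 2 := by
    intro ω
    have hν := nu_nonneg hμ j
    set T := (∑ k ∈ Finset.Icc 1 j, steps ξ α β ω k * μ k) / nu μ j with hT
    have h1 : (∑ k ∈ Finset.Icc 1 j, steps ξ α β ω k * μ k) ^ 2 ≤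
        nu μ j * ∑ k ∈ Finset.Icc 1 j, μ k * steps ξ α β ω k ^ 2 :=
      Finset.sum_sq_le_sum_mul_sum_of_sq_le_mul _
        (fun k hk => (hμ.pos (Finset.mem_Icc.1 hk).1).le)
        (fun k hk => mul_nonneg (hμ.pos (Finset.mem_Icc.1 hk).1).le (sq_nonneg _))
        (fun k _ => le_of_eq (by ring))
    have h2 : T ^ 2 ≤ ∑ k ∈ Finset.Icc 1 j, (μ k / nu μ j) * steps ξ α β ω k ^ 2 := by
      rcases Nat.eq_zero_or_pos j with rfl | hj
      · simp [hT]
      have hν' := nu_pos hμ hj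
      rw [hT, div_pow, div_le_iff₀ (by positivity), Finset.sum_mul]
      refine h1.trans (le_of_eq ?_)
      rw [Finset.mul_sum]
      refine Finset.sum_congr rfl fun k _ => ?_
      field_simp
    have h3 : (p * T) ^ 2 ≤ T ^ 2 := by
      rw [mul_pow]
      exact mul_le_of_le_one_left (sq_nonneg _) (pow_le_one₀ hp hp1)
    have h4 : ∑ k ∈ Finset.Icc 1 j, 2 * (μ k / nu μ j) * steps ξ α β ω k ^ 2 =
        2 * ∑ k ∈ Finset.Icc 1 j, (μ k / nu μ j) * steps ξ α β ω k ^ 2 := by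
      rw [Finset.mul_sum]
      exact Finset.sum_congr rfl fun k _ => by ring
    rw [h4, innov, ← hT]
    nlinarith [sq_nonneg (steps ξ α β ω (j + 1) + p * T)]
  have hi : ∀ k ∈ Finset.Icc 1 j, Integrable
      (fun ω => 2 * (μ k / nu μ j) * steps ξ α β ω k ^ 2) P := fun k _ =>
    (hX k).1.integrable_sq.const_mul _
  have hi1 : Integrable (fun ω => 2 * steps ξ α β ω (j + 1) ^ 2) P :=
    (hX (j + 1)).1.integrable_sq.const_mul 2
  refine (integral_mono (h.memLp_innov hvar hμ hp j).integrable_sq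
    (hi1.add (integrable_finsetSum _ hi)) hj).trans ?_
  simp only [Pi.add_apply]
  rw [integral_add hi1 (integrable_finsetSum _ hi), integral_finsetSum _ hi, integral_const_mul]
  have hsum : ∑ k ∈ Finset.Icc 1 j, ∫ ω, 2 * (μ k / nu μ j) * steps ξ α β ω k ^ 2 ∂P ≤
      ∑ k ∈ Finset.Icc 1 j, 2 * (μ k / nu μ j) := by
    refine Finset.sum_le_sum fun k hk => ?_
    rw [integral_const_mul]
    have := (hμ.pos (Finset.mem_Icc.1 hk).1).le
    have := nu_nonneg hμ j
    exact mul_le_of_le_one_right (by positivity) (hX k).2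
  rw [← Finset.mul_sum, ← Finset.sum_div, show ∑ k ∈ Finset.Icc 1 j, μ k = nu μ j from rfl] at hsum
  have := div_self_le_one (nu μ j)
  have := (hX (j + 1)).2
  linarith

theorem condExp_innov (hμ : RegularlyVarying μ γ) (hp : 0 ≤ p) (j : ℕ) :
    P[fun ω => innov p μ (steps ξ α β ω) j | h.filtration j] =ᵐ[P] 0 := by
  have hX := fun k => (h.memLp_integral_sq_steps hvar hμ hp k).1.integrable (by norm_num)
  rcases j with - | m
  · have h0 : (fun ω => innov p μ (steps ξ α β ω) 0) = ξ 1 := by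
      ext ω; simp [innov, steps, step_one]
    have hind : Indep (inputAlgebra ξ α β (Sum.inl 0)) (h.filtration 0) P := by
      have := indep_iSup_of_disjoint h.inputAlgebra_le h.iIndep_inputAlgebra
        (show Disjoint {Sum.inl 0} (past 0) by simp [past])
      rwa [iSup_singleton] at this
    have := condExp_indep_eq (h.inputAlgebra_le _) (h.filtration.le 0)
      (comap_measurable (ξ 1)).stronglyMeasurable hind
    rw [h0]
    refine this.trans ?_
    rw [h.mean_innovation]
    rfl
  · let A : ℕ → Ω → ℝ := fun k ω => α (m + 2) ω * (if β (m + 2) ω = k then (1 : ℝ) else 0) -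
      p * (μ k / nu μ (m + 1))
    let X : ℕ → Ω → ℝ := fun k ω => steps ξ α β ω k
    let B : Ω → ℝ := fun ω => (1 - α (m + 2) ω) * ξ (m + 2) ω
    have hdecomp : (fun ω => innov p μ (steps ξ α β ω) (m + 1)) =
        (∑ k ∈ Finset.Icc 1 (m + 1), A k * X k) + B := by
      ext ω
      simp only [innov, Pi.add_apply, Finset.sum_apply, Pi.mul_apply, A, X, B]
      rw [steps_add_two]
      simp only [sub_mul, Finset.sum_sub_distrib]
      have : p * ((∑ k ∈ Finset.Icc 1 (m + 1), steps ξ α β ω k * μ k) / nu μ (m + 1)) =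
          ∑ k ∈ Finset.Icc 1 (m + 1), p * (μ k / nu μ (m + 1)) * steps ξ α β ω k := by
        rw [Finset.sum_div, Finset.mul_sum]
        exact Finset.sum_congr rfl fun k _ => by ring
      rw [this]
      ring
    have hAm : ∀ k, StronglyMeasurable[h.presentAlgebra m] (A k) := fun k =>
      ((h.measurable_present_recall m k).sub measurable_const).stronglyMeasurable
    have hBm : StronglyMeasurable[h.presentAlgebra m] B :=
      ((measurable_const.sub (h.measurable_present_indicator m)).mul
        (h.measurable_present_innovation m)).stronglyMeasurable
    have hrec : ∀ k, Integrable (fun ω => α (m + 2) ω *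
        (if β (m + 2) ω = k then (1 : ℝ) else 0)) P := fun k => by
      simpa using h.integrable_recall_mul (m := m) (k := k) (integrable_const (1 : ℝ))
    have hAi : ∀ k, Integrable (A k) P := fun k => (hrec k).sub (integrable_const _)
    have hAXi : ∀ k, Integrable (A k * X k) P := by
      intro k
      refine ((h.integrable_recall_mul (m := m) (k := k) (hX k)).sub
        ((hX k).const_mul (p * (μ k / nu μ (m + 1))))).congr (Eventually.of_forall fun ω => ?_)
      simp only [Pi.sub_apply, Pi.mul_apply, A, X]
      ring
    have hBi : Integrable B P :=
      h.integrable_fresh_mul ((h.memLp_innovation hvar (m + 1)).integrable (by norm_num))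
    have hA0 : ∀ k ∈ Finset.Icc 1 (m + 1), P[A k * X k | h.filtration (m + 1)] =ᵐ[P] 0 := by
      intro k hk
      obtain ⟨hk1, hk2⟩ := Finset.mem_Icc.1 hk
      have e1 := condExp_mul_of_stronglyMeasurable_right
        (h.measurable_filtration_step hk2).stronglyMeasurable (hAXi k) (hAi k)
      have e2 := condExp_indep_eq (h.presentAlgebra_le m) (h.filtration.le (m + 1)) (hAm k)
        (h.indep_present_past m)
      have e3 : ∫ ω, A k ω ∂P = 0 := by
        simp only [A]
        rw [integral_sub (hrec k) (integrable_const _), h.integral_recall m k hk1 hk2]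
        simp
      filter_upwards [e1, e2] with ω h1 h2
      rw [h1, Pi.mul_apply, h2, e3]
      simp
    have hB0 := condExp_indep_eq (h.presentAlgebra_le m) (h.filtration.le (m + 1)) hBm
      (h.indep_present_past m)
    rw [h.integral_fresh m] at hB0
    rw [hdecomp]
    have e4 := condExp_add (integrable_finsetSum' (Finset.Icc 1 (m + 1)) fun k _ => hAXi k) hBi
      (h.filtration (m + 1))
    have e5 := condExp_finsetSum (s := Finset.Icc 1 (m + 1)) (fun k _ => hAXi k)
      (h.filtration (m + 1))
    have e6 : ∀ᵐ ω ∂P, ∀ k ∈ Finset.Icc 1 (m + 1),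
        (P[A k * X k | h.filtration (m + 1)]) ω = 0 :=
      (ae_ball_iff (Finset.Icc 1 (m + 1)).countable_toSet).2 hA0
    filter_upwards [e4, e5, e6, hB0] with ω h4 h5 h6 h7
    rw [h4, Pi.add_apply, h5, h7, Finset.sum_apply, Finset.sum_eq_zero h6]
    simp

end IsInput

end RVSRRW

/-! ### The Skorohod distance and uniform convergence -/

theorem tsum_two_inv_pow_succ : ∑' m : ℕ, (2⁻¹ : ℝ≥0∞) ^ (m + 1) = 1 := by
  simp_rw [pow_succ]
  rw [ENNReal.tsum_mul_right, ENNReal.tsum_geometric, ENNReal.one_sub_inv_two, inv_inv]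
  exact ENNReal.mul_inv_cancel two_ne_zero ENNReal.ofNat_ne_top

theorem tendsto_tsum_two_inv_pow_mul_min {ι : Type*} {l : Filter ι} [l.IsCountablyGenerated]
    {f : ι → ℕ → ℝ≥0∞} (hf : ∀ m, Tendsto (fun i => f i m) l (𝓝 0)) :
    Tendsto (fun i => ∑' m : ℕ, (2⁻¹ : ℝ≥0∞) ^ (m + 1) * min 1 (f i m)) l (𝓝 0) := by
  have h := tendsto_lintegral_filter_of_dominated_convergence (μ := Measure.count) (l := l)
    (F := fun i (m : ℕ) => (2⁻¹ : ℝ≥0∞) ^ (m + 1) * min 1 (f i m)) (f := fun _ => 0)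
    (fun m : ℕ => (2⁻¹ : ℝ≥0∞) ^ (m + 1))
    (Eventually.of_forall fun i => measurable_from_nat)
    (Eventually.of_forall fun i => Eventually.of_forall fun m =>
      mul_le_of_le_one_right zero_le (min_le_left _ _))
    (by rw [lintegral_count, tsum_two_inv_pow_succ]; exact ENNReal.one_ne_top)
    (Eventually.of_forall fun m => by
      have h1 : Tendsto (fun i => min 1 (f i m)) l (𝓝 0) :=
        tendsto_of_tendsto_of_tendsto_of_le_of_le tendsto_const_nhds (hf m)
          (fun _ => zero_le) fun _ => min_le_right _ _
      have := ENNReal.Tendsto.const_mul (a := (2⁻¹ : ℝ≥0∞) ^ (m + 1)) h1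
        (Or.inr (ENNReal.pow_ne_top (by simp)))
      rwa [mul_zero] at this)
  simpa only [lintegral_count, lintegral_zero] using h

namespace SkorokhodSpace

theorem distOn_le_iSup_edist (T : ℝ≥0) (x y : ℝ≥0 → ℝ) :
    distOn T x y ≤ ⨆ t : Icc (0 : ℝ≥0) T, edist (x t) (y t) := by
  refine iInf_le_of_le (OrderIso.refl _) (max_le ?_ le_rfl)
  rw [distortion_refl]
  exact zero_le

theorem edist_cutoff_mul_le (T t : ℝ≥0) (a b : ℝ) :
    edist (cutoff T t * a) (cutoff T t * b) ≤ edist a b := by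
  rw [edist_dist, edist_dist]
  refine ENNReal.ofReal_le_ofReal ?_
  rw [Real.dist_eq, Real.dist_eq, ← mul_sub, abs_mul]
  refine mul_le_of_le_one_left (abs_nonneg _) ?_
  rw [cutoff, abs_of_nonneg (le_max_left _ _)]
  exact max_le zero_le_one (min_le_left _ _)

/-- The Skorohod distance is controlled by the uniform distances on the intervals `[0, m]`. -/
theorem edist_le_tsum (x y : SkorokhodSpace) :
    edist x y ≤ ∑' m : ℕ, (2⁻¹ : ℝ≥0∞) ^ (m + 1) *
      min 1 (⨆ t : Icc (0 : ℝ≥0) ((m : ℝ≥0) + 1), edist (x t) (y t)) := by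
  refine ENNReal.tsum_le_tsum fun m => mul_le_mul_right (min_le_min le_rfl ?_) _
  exact (distOn_le_iSup_edist _ _ _).trans (iSup_mono fun t => edist_cutoff_mul_le _ _ _ _)

/-- Locally uniform convergence implies convergence in the Skorohod topology. -/
theorem tendsto_of_forall_iSup_edist {ι : Type*} {l : Filter ι} [l.IsCountablyGenerated]
    {f : ι → SkorokhodSpace} {g : SkorokhodSpace}
    (h : ∀ T : ℝ≥0, Tendsto (fun i => ⨆ t : Icc (0 : ℝ≥0) T, edist (f i t) (g t)) l (𝓝 0)) :
    Tendsto f l (𝓝 g) := by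
  rw [tendsto_iff_edist_tendsto_0]
  exact tendsto_of_tendsto_of_tendsto_of_le_of_le tendsto_const_nhds
    (tendsto_tsum_two_inv_pow_mul_min fun m : ℕ => h ((m : ℝ≥0) + 1)) (fun _ => zero_le)
    fun i => edist_le_tsum _ _

/-- A continuous function as an element of the Skorohod space. -/
def ofContinuous (f : ℝ≥0 → ℝ) (hf : Continuous f) : SkorokhodSpace where
  path := f
  right_cont _ := hf.continuousWithinAt
  left_lim t := ⟨f t, (hf.tendsto t).mono_left nhdsWithin_le_nhds⟩

theorem continuous_ofContinuous_mul (f : ℝ≥0 → ℝ) (hf : Continuous f) :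
    Continuous fun c : ℝ => ofContinuous (fun t => f t * c) (hf.mul continuous_const) := by
  rw [continuous_iff_continuousAt]
  intro c
  refine tendsto_of_forall_iSup_edist fun T => ?_
  obtain ⟨C, hC⟩ := isCompact_Icc.exists_bound_of_continuousOn (s := Icc (0 : ℝ≥0) T)
    hf.continuousOn
  have h1 : Tendsto (fun c' : ℝ => ENNReal.ofReal C * edist c' c) (𝓝 c) (𝓝 0) := by
    have := ENNReal.Tendsto.const_mul (a := ENNReal.ofReal C)
      (tendsto_iff_edist_tendsto_0.1 (tendsto_id (x := 𝓝 c))) (Or.inr ENNReal.ofReal_ne_top)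
    rwa [mul_zero] at this
  refine tendsto_of_tendsto_of_tendsto_of_le_of_le tendsto_const_nhds h1 (fun _ => zero_le)
    fun c' => iSup_le fun t => ?_
  change edist (f t * c') (f t * c) ≤ _
  have hC0 : 0 ≤ C := (norm_nonneg _).trans (hC t t.2)
  rw [edist_dist, edist_dist, ← ENNReal.ofReal_mul hC0]
  refine ENNReal.ofReal_le_ofReal ?_
  rw [Real.dist_eq, Real.dist_eq, ← mul_sub, abs_mul]
  gcongr
  exact hC t t.2

theorem continuous_scaledPath (c : ℝ) (n : ℕ) :
    Continuous fun s : ℕ → ℝ => scaledPath c s n := by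
  rw [continuous_iff_continuousAt]
  intro s
  refine tendsto_of_forall_iSup_edist fun T => ?_
  have h1 : Tendsto (fun s' : ℕ → ℝ =>
      ∑ k ∈ Finset.range (⌊(n : ℝ≥0) * T⌋₊ + 1), edist (c * s' k) (c * s k)) (𝓝 s) (𝓝 0) := by
    rw [← Finset.sum_const_zero (s := Finset.range (⌊(n : ℝ≥0) * T⌋₊ + 1))]
    refine tendsto_finsetSum _ fun k _ => tendsto_iff_edist_tendsto_0.1 ?_
    exact (continuous_const.mul (continuous_apply k)).tendsto s
  refine tendsto_of_tendsto_of_tendsto_of_le_of_le tendsto_const_nhds h1 (fun _ => zero_le)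
    fun s' => iSup_le fun t => ?_
  refine Finset.single_le_sum (f := fun k => edist (c * s' k) (c * s k))
    (fun _ _ => zero_le) (Finset.mem_range.2 (Nat.lt_succ_of_le (Nat.floor_mono ?_)))
  exact mul_le_mul_right t.2.2 _

end SkorokhodSpace

/-! ### Pathwise convergence of the rescaled walk -/

theorem natFloor_natCast_mul_coe (n : ℕ) (t : ℝ≥0) : ⌊(n : ℝ) * (t : ℝ)⌋₊ = ⌊(n : ℝ≥0) * t⌋₊ := by
  rw [← NNReal.coe_natCast, ← NNReal.coe_mul]
  exact Nonneg.nat_floor_coe _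

namespace RVSRRW

/-- A random upper bound for `sup_{t ≤ T} |a_n μ_n S_{⌊nt⌋} - Y t|`, where `S` is the walk with
steps `X` and `Y t = p κ t ^ δ L`, with `κ = (γ + 1) / δ` and `δ = p (γ + 1) - γ`. It separates the
deviation of `S` from `p L W` and the deterministic deviation of the rescaled `W` from its limit,
`W` being the sums of the weights. -/
noncomputable def deviation (γ p : ℝ) (μ : ℕ → ℝ) (T : ℝ≥0) (n : ℕ) (X : ℕ → ℝ) (L : ℝ) : ℝ≥0∞ :=
  (⨆ (m : ℕ) (_ : m ≤ ⌊(n : ℝ≥0) * T⌋₊), ‖coeff p μ n * μ n *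
      (∑ k ∈ Finset.Icc 1 m, X k - p * L * weightSum p μ m)‖ₑ) +
    ‖p * L‖ₑ * ⨆ t : Icc (0 : ℝ≥0) T,
      edist (coeff p μ n * μ n * weightSum p μ ⌊(n : ℝ≥0) * (t : ℝ≥0)⌋₊)
        ((γ + 1) / (p * (γ + 1) - γ) * ((t : ℝ≥0) : ℝ) ^ (p * (γ + 1) - γ))

variable {γ p : ℝ} {μ : ℕ → ℝ}

theorem iSup_edist_le_deviation (T : ℝ≥0) (n : ℕ) (X : ℕ → ℝ) (L : ℝ) :
    ⨆ t : Icc (0 : ℝ≥0) T,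
        edist (coeff p μ n * μ n * ∑ k ∈ Finset.Icc 1 ⌊(n : ℝ≥0) * (t : ℝ≥0)⌋₊, X k)
          (p * (γ + 1) / (p * (γ + 1) - γ) * ((t : ℝ≥0) : ℝ) ^ (p * (γ + 1) - γ) * L) ≤
      deviation γ p μ T n X L := by
  refine iSup_le fun t => ?_
  set m := ⌊(n : ℝ≥0) * (t : ℝ≥0)⌋₊
  set f := (γ + 1) / (p * (γ + 1) - γ) * ((t : ℝ≥0) : ℝ) ^ (p * (γ + 1) - γ) with hf
  have hm : m ≤ ⌊(n : ℝ≥0) * T⌋₊ := Nat.floor_mono (mul_le_mul_right t.2.2 _)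
  have h1 : edist (coeff p μ n * μ n * ∑ k ∈ Finset.Icc 1 m, X k)
      (coeff p μ n * μ n * (p * L * weightSum p μ m)) =
      ‖coeff p μ n * μ n * (∑ k ∈ Finset.Icc 1 m, X k - p * L * weightSum p μ m)‖ₑ := by
    rw [edist_eq_enorm_sub, mul_sub]
  have h2 : edist (coeff p μ n * μ n * (p * L * weightSum p μ m)) (p * L * f) =
      ‖p * L‖ₑ * edist (coeff p μ n * μ n * weightSum p μ m) f := by
    rw [edist_eq_enorm_sub, edist_eq_enorm_sub, ← enorm_mul]
    congr 1
    ring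
  have h3 : p * (γ + 1) / (p * (γ + 1) - γ) * ((t : ℝ≥0) : ℝ) ^ (p * (γ + 1) - γ) * L =
      p * L * f := by rw [hf]; ring
  rw [h3]
  refine (edist_triangle _ (coeff p μ n * μ n * (p * L * weightSum p μ m)) _).trans ?_
  rw [h1, h2]
  refine add_le_add ?_ ?_
  · exact le_iSup₂ (f := fun m (_ : m ≤ ⌊(n : ℝ≥0) * T⌋₊) => ‖coeff p μ n * μ n *
      (∑ k ∈ Finset.Icc 1 m, X k - p * L * weightSum p μ m)‖ₑ) m hm
  · gcongr
    exact le_iSup (fun t : Icc (0 : ℝ≥0) T =>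
      edist (coeff p μ n * μ n * weightSum p μ ⌊(n : ℝ≥0) * (t : ℝ≥0)⌋₊)
        ((γ + 1) / (p * (γ + 1) - γ) * ((t : ℝ≥0) : ℝ) ^ (p * (γ + 1) - γ))) t

variable (hγ : -1 < γ) (hμ : RegularlyVarying μ γ) (hp0 : 0 ≤ p) (hp1 : p ≤ 1)
  (hδ : 0 < p * (γ + 1) - γ)
include hγ hμ hp0 hp1 hδ

theorem tendsto_iSup_edist_weightSum (T : ℝ≥0) :
    Tendsto (fun n : ℕ => ⨆ t : Icc (0 : ℝ≥0) T,
      edist (coeff p μ n * μ n * weightSum p μ ⌊(n : ℝ≥0) * (t : ℝ≥0)⌋₊)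
        ((γ + 1) / (p * (γ + 1) - γ) * ((t : ℝ≥0) : ℝ) ^ (p * (γ + 1) - γ))) atTop (𝓝 0) := by
  have h := tendstoUniformlyOn_weightSum hγ hμ hp0 hp1 hδ (T : ℝ)
  rw [EMetric.tendstoUniformlyOn_iff] at h
  rw [ENNReal.tendsto_nhds_zero]
  intro ε hε
  filter_upwards [h ε hε] with n hn
  refine iSup_le fun t => ?_
  have := hn ((t : ℝ≥0) : ℝ) ⟨(t : ℝ≥0).2, by exact_mod_cast t.2.2⟩
  rw [edist_comm, natFloor_natCast_mul_coe] at this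
  exact this.le

theorem exists_coeff_mul_weightSum_floor_le (T : ℝ≥0) :
    ∃ A : ℝ, 0 < A ∧ ∀ᶠ n : ℕ in atTop,
      coeff p μ n * μ n * weightSum p μ ⌊(n : ℝ≥0) * T⌋₊ ≤ A := by
  have h := (tendstoUniformlyOn_weightSum hγ hμ hp0 hp1 hδ (T : ℝ)).tendsto_at
    (show (T : ℝ) ∈ Icc (0 : ℝ) T from ⟨T.2, le_rfl⟩)
  refine ⟨max 1 ((γ + 1) / (p * (γ + 1) - γ) * (T : ℝ) ^ (p * (γ + 1) - γ) + 1), by positivity, ?_⟩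
  filter_upwards [h.eventually_lt_const (lt_add_one _)] with n hn
  rw [natFloor_natCast_mul_coe] at hn
  exact hn.le.trans (le_max_right _ _)

theorem tendsto_coeff_mul_zero (hv : BddAbove (range (v p μ))) :
    Tendsto (fun n => coeff p μ n * μ n) atTop (𝓝 0) := by
  have hW := (tendsto_add_atTop_iff_nat 2).1 (tendsto_weightSum_atTop hγ hμ hp0 hp1 hδ hv)
  refine ((tendsto_coeff_mul_weightSum hγ hμ hp0 hp1 hδ).div_atTop hW).congr' ?_
  filter_upwards [eventually_ge_atTop 2] with n hn
  obtain ⟨m, rfl⟩ : ∃ m, n = m + 2 := ⟨n - 2, by omega⟩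
  rw [mul_div_cancel_right₀ _ (weightSum_pos hμ hp0 m).ne']

/-- The deviation tends to zero along every path for which `M` and its transform
`∑_{j<n} D_j / W_{j+2}` converge. -/
theorem tendsto_deviation (hv : BddAbove (range (v p μ))) {X : ℕ → ℝ} {L L' : ℝ}
    (hM : Tendsto (fun n => coeff p μ n * ∑ k ∈ Finset.Icc 1 n, X k * μ k) atTop (𝓝 L))
    (hK : Tendsto (fun n => ∑ j ∈ Finset.range n, (weightSum p μ (j + 2))⁻¹ * innov p μ X j)
      atTop (𝓝 L')) (T : ℝ≥0) :
    Tendsto (fun n => deviation γ p μ T n X L) atTop (𝓝 0) := by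
  obtain ⟨C, -, hC⟩ := exists_weightSum_add_two_le hγ hμ hp0 hp1 hδ
  have ho := isLittleO_sum_steps_sub hμ hp0 (tendsto_weightSum_atTop hγ hμ hp0 hp1 hδ hv) hC hM hK
  set r : ℕ → ℝ := fun m => ∑ k ∈ Finset.Icc 1 m, X k - p * L * weightSum p μ m with hr
  obtain ⟨A, hA, hAev⟩ := exists_coeff_mul_weightSum_floor_le hγ hμ hp0 hp1 hδ T
  have hb0 := tendsto_coeff_mul_zero hγ hμ hp0 hp1 hδ hv
  have hbpos := regularlyVarying_coeff_mul hγ hμ hp0 hp1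
  have h1 : Tendsto (fun n : ℕ => ⨆ (m : ℕ) (_ : m ≤ ⌊(n : ℝ≥0) * T⌋₊),
      ‖coeff p μ n * μ n * r m‖ₑ) atTop (𝓝 0) := by
    refine ENNReal.tendsto_nhds_zero.2 fun ε hε => ?_
    obtain ⟨e, he0, heε⟩ : ∃ e : ℝ, 0 < e ∧ ENNReal.ofReal e ≤ ε := by
      rcases eq_or_ne ε ∞ with rfl | hε'
      · exact ⟨1, one_pos, le_top⟩
      · exact ⟨ε.toReal, ENNReal.toReal_pos hε.ne' hε', ENNReal.ofReal_toReal_le⟩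
    obtain ⟨N, hN⟩ := eventually_atTop.1 (ho.bound (show 0 < e / (2 * A) by positivity))
    let C₀ := ∑ m ∈ Finset.range N, |r m|
    have hC₀ : 0 ≤ C₀ := Finset.sum_nonneg fun _ _ => abs_nonneg _
    have hrle : ∀ m, |r m| ≤ C₀ + e / (2 * A) * weightSum p μ m := by
      intro m
      have hU := weightSum_nonneg hμ hp0 m
      rcases lt_or_ge m N with hm | hm
      · have : |r m| ≤ C₀ := Finset.single_le_sum (f := fun m => |r m|)
          (fun _ _ => abs_nonneg _) (Finset.mem_range.2 hm)
        have : 0 ≤ e / (2 * A) * weightSum p μ m := by positivity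
        linarith
      · have := hN m hm
        rw [Real.norm_eq_abs, Real.norm_of_nonneg hU] at this
        linarith
    have hb0' : Tendsto (fun n => coeff p μ n * μ n * C₀) atTop (𝓝 0) := by
      simpa using hb0.mul_const C₀
    filter_upwards [hb0'.eventually_lt_const (half_pos he0), hAev, eventually_ge_atTop 1]
      with n h2 h3 hn
    refine iSup₂_le fun m hm => le_trans ?_ heε
    have hb := (hbpos.pos hn).le
    rw [Real.enorm_eq_ofReal_abs, abs_mul, abs_of_nonneg hb]
    refine ENNReal.ofReal_le_ofReal ?_
    calc coeff p μ n * μ n * |r m|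
        ≤ coeff p μ n * μ n * (C₀ + e / (2 * A) * weightSum p μ ⌊(n : ℝ≥0) * T⌋₊) := by
          refine mul_le_mul_of_nonneg_left ((hrle m).trans ?_) hb
          gcongr
          exact weightSum_mono hμ hp0 hm
      _ = coeff p μ n * μ n * C₀ +
          e / (2 * A) * (coeff p μ n * μ n * weightSum p μ ⌊(n : ℝ≥0) * T⌋₊) := by ring
      _ ≤ e / 2 + e / (2 * A) * A := by gcongr
      _ = e := by field_simp; ring
  have h2 := ENNReal.Tendsto.const_mul (a := ‖p * L‖ₑ)
    (tendsto_iSup_edist_weightSum hγ hμ hp0 hp1 hδ T) (Or.inr enorm_ne_top)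
  have h3 := h1.add h2
  rw [mul_zero, add_zero] at h3
  exact h3

/-- The deviation is dominated by the maximal functions of `M` and of its transform. -/
theorem exists_deviation_le (T : ℝ≥0) :
    ∃ C : ℝ≥0, ∀ᶠ n in atTop, ∀ (X : ℕ → ℝ) (L : ℝ) (G : ℝ≥0∞),
      (∀ n, ‖coeff p μ n * ∑ k ∈ Finset.Icc 1 n, X k * μ k‖ₑ ≤ G) →
      (∀ n, ‖∑ j ∈ Finset.range n, (weightSum p μ (j + 2))⁻¹ * innov p μ X j‖ₑ ≤ G) →
      ‖L‖ₑ ≤ G → deviation γ p μ T n X L ≤ C * G := by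
  obtain ⟨A, hA, hAev⟩ := exists_coeff_mul_weightSum_floor_le hγ hμ hp0 hp1 hδ (T + 2)
  have hbpos := regularlyVarying_coeff_mul hγ hμ hp0 hp1
  refine ⟨Real.toNNReal (4 * A) + 1, ?_⟩
  filter_upwards [hAev, eventually_ge_atTop 1,
    ENNReal.tendsto_nhds_zero.1 (tendsto_iSup_edist_weightSum hγ hμ hp0 hp1 hδ T) 1 one_pos]
    with n hn hn1 hs X L G hM hK hL
  rcases eq_or_ne G ∞ with rfl | hG
  · rw [ENNReal.mul_top (by positivity)]
    exact le_top
  have hreal : ∀ x : ℝ, ‖x‖ₑ ≤ G → |x| ≤ G.toReal := by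
    intro x hx
    rw [Real.enorm_eq_ofReal_abs] at hx
    exact (ENNReal.ofReal_le_iff_le_toReal hG).1 hx
  set R := G.toReal with hR
  have hR0 : 0 ≤ R := ENNReal.toReal_nonneg
  have hGR : G = ENNReal.ofReal R := (ENNReal.ofReal_toReal hG).symm
  have hL' := hreal L hL
  have hb := (hbpos.pos hn1).le
  have hpL : ‖p * L‖ₑ ≤ G := by
    rw [hGR, Real.enorm_eq_ofReal_abs, abs_mul, abs_of_nonneg hp0]
    exact ENNReal.ofReal_le_ofReal ((mul_le_of_le_one_left (abs_nonneg _) hp1).trans hL')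
  rw [ENNReal.coe_add, ENNReal.coe_one, add_mul, one_mul]
  refine add_le_add (iSup₂_le fun m hm => ?_) ((mul_le_mul' hpL hs).trans (mul_one _).le)
  have hS := abs_sum_steps_le hμ hp0 (fun n => hreal _ (hM n)) (fun n => hreal _ (hK n)) m
  have hU2 := weightSum_nonneg hμ hp0 (m + 2)
  have hU := weightSum_nonneg hμ hp0 m
  have hUU : weightSum p μ m ≤ weightSum p μ (m + 2) := weightSum_mono hμ hp0 (by omega)
  have hmT : weightSum p μ (m + 2) ≤ weightSum p μ ⌊(n : ℝ≥0) * (T + 2)⌋₊ := by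
    refine weightSum_mono hμ hp0 (Nat.le_floor ?_)
    have h1 : (m : ℝ≥0) ≤ n * T := (Nat.le_floor_iff zero_le).1 hm
    have h2 : (1 : ℝ≥0) ≤ n := by exact_mod_cast hn1
    push_cast
    rw [mul_add]
    refine add_le_add h1 ?_
    exact le_mul_of_one_le_left zero_le h2
  have hr : |∑ k ∈ Finset.Icc 1 m, X k - p * L * weightSum p μ m| ≤
      4 * R * weightSum p μ (m + 2) := by
    have h1 : |p * L * weightSum p μ m| ≤ R * weightSum p μ (m + 2) := by
      rw [abs_mul, abs_mul, abs_of_nonneg hp0, abs_of_nonneg hU]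
      refine mul_le_mul ?_ hUU hU hR0
      exact (mul_le_of_le_one_left (abs_nonneg _) hp1).trans hL'
    have h2 : weightSum p μ (m + 2) * (2 * R + p * R) ≤ weightSum p μ (m + 2) * (3 * R) :=
      mul_le_mul_of_nonneg_left (by nlinarith) hU2
    refine (abs_sub _ _).trans ?_
    linarith
  rw [Real.enorm_eq_ofReal_abs, abs_mul, abs_of_nonneg hb, hGR, ← ENNReal.ofReal,
    ← ENNReal.ofReal_mul (by positivity)]
  refine ENNReal.ofReal_le_ofReal ?_
  calc coeff p μ n * μ n * |∑ k ∈ Finset.Icc 1 m, X k - p * L * weightSum p μ m|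
      ≤ coeff p μ n * μ n * (4 * R * weightSum p μ ⌊(n : ℝ≥0) * (T + 2)⌋₊) := by
        refine mul_le_mul_of_nonneg_left (hr.trans ?_) hb
        gcongr
    _ = 4 * R * (coeff p μ n * μ n * weightSum p μ ⌊(n : ℝ≥0) * (T + 2)⌋₊) := by ring
    _ ≤ 4 * R * A := by gcongr
    _ = 4 * A * R := by ring

end RVSRRW

/-! ### Convergence of the martingale and of the walk -/

/-- Dominated convergence in `L²`. -/
theorem tendsto_lintegral_sq_of_dominated {Ω : Type*} [MeasurableSpace Ω] {P : Measure Ω}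
    {f : ℕ → Ω → ℝ≥0∞} {G : Ω → ℝ≥0∞} (C : ℝ≥0) (hf : ∀ n, Measurable (f n))
    (hle : ∀ᶠ n in atTop, ∀ᵐ ω ∂P, f n ω ≤ C * G ω) (hG : ∫⁻ ω, G ω ^ 2 ∂P < ∞)
    (hlim : ∀ᵐ ω ∂P, Tendsto (fun n => f n ω) atTop (𝓝 0)) :
    Tendsto (fun n => ∫⁻ ω, f n ω ^ 2 ∂P) atTop (𝓝 0) := by
  have h := tendsto_lintegral_filter_of_dominated_convergence (μ := P) (l := atTop)
    (F := fun n ω => f n ω ^ 2) (f := fun _ => 0) (fun ω => (C : ℝ≥0∞) ^ 2 * G ω ^ 2)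
    (Eventually.of_forall fun n => (hf n).pow_const 2)
    (hle.mono fun n hn => hn.mono fun ω hω => by
      rw [← mul_pow]
      exact pow_le_pow_left' hω 2)
    (by
      rw [lintegral_const_mul' _ _ (by simp)]
      exact (ENNReal.mul_lt_top (by simp) hG).ne)
    (hlim.mono fun ω hω => by simpa using ENNReal.Tendsto.pow (n := 2) hω)
  simpa using h

namespace RVSRRW

variable {Ω : Type*} [m0 : MeasurableSpace Ω] {P : Measure Ω} [IsProbabilityMeasure P]
  {γ p : ℝ} {μ : ℕ → ℝ} {ξ α : ℕ → Ω → ℝ} {β : ℕ → Ω → ℕ}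

/-- Transforms of the martingale differences by square summable weights converge almost surely,
with a square integrable maximal function. -/
theorem IsInput.exists_tendsto_sum_innov (h : IsInput P p μ ξ α β)
    (hvar : ∫ ω, ξ 1 ω ^ 2 ∂P = 1) (hμ : RegularlyVarying μ γ) (hp0 : 0 ≤ p) (hp1 : p ≤ 1)
    {θ : ℕ → ℝ} (hθ : Summable fun j => θ j ^ 2) :
    (∃ L : Ω → ℝ, Measurable L ∧ ∀ᵐ ω ∂P, Tendsto
      (fun n => ∑ j ∈ Finset.range n, θ j * innov p μ (steps ξ α β ω) j) atTop (𝓝 (L ω))) ∧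
    ∫⁻ ω, (⨆ n, ‖∑ j ∈ Finset.range n, θ j * innov p μ (steps ξ α β ω) j‖ₑ) ^ 2 ∂P < ∞ := by
  let D : ℕ → Ω → ℝ := fun j ω => θ j * innov p μ (steps ξ α β ω) j
  have hDm : ∀ j, StronglyMeasurable[h.filtration (j + 1)] (D j) := fun j =>
    (h.stronglyMeasurable_innov j).const_mul (θ j)
  have hD2 : ∀ j, MemLp (D j) 2 P := fun j => (h.memLp_innov hvar hμ hp0 j).const_mul (θ j)
  have hD0 : ∀ j, P[D j | h.filtration j] =ᵐ[P] 0 := by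
    intro j
    have h1 := condExp_smul (μ := P) (θ j) (fun ω => innov p μ (steps ξ α β ω) j) (h.filtration j)
    filter_upwards [h1, h.condExp_innov hvar hμ hp0 j] with ω h2 h3
    change (P[θ j • (fun ω => innov p μ (steps ξ α β ω) j) | h.filtration j]) ω = 0
    rw [h2, Pi.smul_apply, h3]
    simp
  have hsum : Summable fun j => ∫ ω, D j ω ^ 2 ∂P := by
    refine Summable.of_nonneg_of_le (fun j => integral_nonneg fun ω => sq_nonneg _) (fun j => ?_)
      (hθ.mul_right 4)
    simp only [D, mul_pow]
    rw [integral_const_mul]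
    exact mul_le_mul_of_nonneg_left (h.integral_sq_innov_le hvar hμ hp0 hp1 j) (sq_nonneg _)
  exact ⟨exists_tendsto_sum_differences hDm hD2 hD0 hsum, lintegral_iSup_sq_lt_top hDm hD2 hD0 hsum⟩

omit [IsProbabilityMeasure P] in
theorem measurable_deviation (h : IsInput P p μ ξ α β) {L : Ω → ℝ} (hL : Measurable L) (T : ℝ≥0)
    (n : ℕ) : Measurable fun ω => deviation γ p μ T n (steps ξ α β ω) (L ω) := by
  refine Measurable.add (Measurable.iSup fun m => Measurable.iSup fun _ => ?_)
    ((hL.const_mul p).enorm.mul_const _)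
  exact (((Finset.measurable_fun_sum _ fun k _ => h.measurable_steps k).sub
    ((hL.const_mul p).mul_const _)).const_mul _).enorm

omit [IsProbabilityMeasure P] in
theorem measurable_process (h : IsInput P p μ ξ α β) (n : ℕ) :
    Measurable (process p μ ξ α β n) :=
  (SkorokhodSpace.continuous_scaledPath (coeff p μ n * μ n) n).measurable.comp
    (measurable_pi_lambda _ fun m =>
      Finset.measurable_fun_sum (Finset.Icc 1 m) fun k _ => h.measurable_steps k)

end RVSRRW

theorem mainTheorem3 {Ω : Type*} [MeasurableSpace Ω] (P : Measure Ω) [IsProbabilityMeasure P]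
    (γ : ℝ) (hγ : -1 < γ) (μ : ℕ → ℝ) (hμ : RegularlyVarying μ γ)
    (p : ℝ) (hp0 : 0 ≤ p) (hp1 : p ≤ 1)
    (ξ α : ℕ → Ω → ℝ) (β : ℕ → Ω → ℕ) (hinput : RVSRRW.IsInput P p μ ξ α β)
    (hvar : ∫ ω, ξ 1 ω ^ 2 ∂P = 1)
    (hv : BddAbove (range (RVSRRW.v p μ))) :
    (γ + 1 / 2) / (γ + 1) ≤ p ∧
    ∃ Minf : Ω → ℝ, Measurable Minf ∧ MemLp Minf 2 P ∧
      -- `Minf` is the almost sure and `L²` limit of the martingale `M n`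
      (∀ᵐ ω ∂P, Tendsto
        (fun n => RVSRRW.mart p μ (fun k => ξ k ω) (fun k => α k ω) (fun k => β k ω) n)
        atTop (𝓝 (Minf ω))) ∧
      Tendsto (fun n => eLpNorm (fun ω =>
          RVSRRW.mart p μ (fun k => ξ k ω) (fun k => α k ω) (fun k => β k ω) n - Minf ω) 2 P)
        atTop (𝓝 0) ∧
      -- the limit process and the scaled walks are random elements of `D([0,∞))`
      ∃ Y : Ω → SkorokhodSpace,
        (∀ ω t, Y ω t = p * (γ + 1) / (p * (γ + 1) - γ) *
          (t : ℝ) ^ (p * (γ + 1) - γ) * Minf ω) ∧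
        Measurable Y ∧
        (∀ n, Measurable (RVSRRW.process p μ ξ α β n)) ∧
        -- almost sure convergence in the Skorohod topology
        (∀ᵐ ω ∂P, Tendsto (fun n => RVSRRW.process p μ ξ α β n ω) atTop (𝓝 (Y ω))) ∧
        -- `L²` convergence, for the Skorohod metric and for the uniform distance on each `[0, T]`
        Tendsto (fun n => ∫⁻ ω, edist (RVSRRW.process p μ ξ α β n ω) (Y ω) ^ 2 ∂P)
          atTop (𝓝 0) ∧
        ∀ T : ℝ≥0, Tendsto (fun n => ∫⁻ ω, (⨆ t : Icc (0 : ℝ≥0) T,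
            edist (RVSRRW.process p μ ξ α β n ω t) (Y ω t)) ^ 2 ∂P)
          atTop (𝓝 0) := by
  open RVSRRW in
  have hhalf := one_half_le_index hγ hμ hp0 hp1 hv
  have hδ : 0 < p * (γ + 1) - γ := by linarith
  refine ⟨by rw [div_le_iff₀ (by linarith)]; linarith, ?_⟩
  let M : ℕ → Ω → ℝ := fun n ω =>
    coeff p μ n * ∑ k ∈ Finset.Icc 1 n, steps ξ α β ω k * μ k
  let K : ℕ → Ω → ℝ := fun n ω =>
    ∑ j ∈ Finset.range n, (weightSum p μ (j + 2))⁻¹ * innov p μ (steps ξ α β ω) j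
  obtain ⟨⟨L, hL, hML⟩, hMG⟩ := hinput.exists_tendsto_sum_innov hvar hμ hp0 hp1
    (summable_coeff_mul_sq hv)
  obtain ⟨⟨L', -, hKL⟩, hKG⟩ := hinput.exists_tendsto_sum_innov hvar hμ hp0 hp1
    (summable_inv_weightSum_sq hγ hμ hp0 hp1 hδ hv)
  simp only [← coeff_mul_sum_eq hμ hp0] at hML hMG
  have hMm : ∀ n, Measurable (M n) := fun n =>
    (Finset.measurable_fun_sum _ fun k _ => (hinput.measurable_steps k).mul_const _).const_mul _
  -- the common dominating function
  let G : Ω → ℝ≥0∞ := fun ω => (⨆ n, ‖M n ω‖ₑ) + ⨆ n, ‖K n ω‖ₑ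
  have hMle : ∀ ω n, ‖M n ω‖ₑ ≤ G ω := fun ω n =>
    (le_iSup (fun n => ‖M n ω‖ₑ) n).trans le_self_add
  have hKle : ∀ ω n, ‖K n ω‖ₑ ≤ G ω := fun ω n =>
    (le_iSup (fun n => ‖K n ω‖ₑ) n).trans le_add_self
  have hLle : ∀ᵐ ω ∂P, ‖L ω‖ₑ ≤ G ω := hML.mono fun ω hω =>
    le_of_tendsto hω.enorm (Eventually.of_forall fun n => hMle ω n)
  have hG : ∫⁻ ω, G ω ^ 2 ∂P < ∞ := by
    have hle : ∀ ω, G ω ^ 2 ≤ 4 * ((⨆ n, ‖M n ω‖ₑ) ^ 2 + (⨆ n, ‖K n ω‖ₑ) ^ 2) := by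
      intro ω
      simp only [G]
      generalize (⨆ n, ‖M n ω‖ₑ) = a
      generalize (⨆ n, ‖K n ω‖ₑ) = b
      have hmax : max a b ^ 2 ≤ a ^ 2 + b ^ 2 := by
        rcases le_total a b with hab | hab
        · rw [max_eq_right hab]; exact le_add_self
        · rw [max_eq_left hab]; exact le_self_add
      calc (a + b) ^ 2 ≤ (max a b + max a b) ^ 2 :=
            pow_le_pow_left' (add_le_add (le_max_left _ _) (le_max_right _ _)) 2
        _ = 4 * max a b ^ 2 := by ring
        _ ≤ 4 * (a ^ 2 + b ^ 2) := by gcongr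
    refine (lintegral_mono hle).trans_lt ?_
    rw [lintegral_const_mul' _ _ (by simp),
      lintegral_add_left ((Measurable.iSup fun n => (hMm n).enorm).pow_const 2)]
    exact ENNReal.mul_lt_top (by simp) (ENNReal.add_lt_top.2 ⟨hMG, hKG⟩)
  have hnorm : ∀ f : Ω → ℝ, eLpNorm f 2 P = (∫⁻ ω, ‖f ω‖ₑ ^ 2 ∂P) ^ (1 / 2 : ℝ) := fun f => by
    rw [eLpNorm_eq_lintegral_rpow_enorm_toReal two_ne_zero ENNReal.ofNat_ne_top]
    simp
  have hL2 : MemLp L 2 P := by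
    refine ⟨hL.aestronglyMeasurable, ?_⟩
    rw [hnorm]
    refine ENNReal.rpow_lt_top_of_nonneg (by norm_num) (ne_top_of_le_ne_top hG.ne ?_)
    exact lintegral_mono_ae (hLle.mono fun ω hω => pow_le_pow_left' hω 2)
  refine ⟨L, hL, hL2, hML, ?_, ?_⟩
  · have h := tendsto_lintegral_sq_of_dominated (P := P) (f := fun n ω => ‖M n ω - L ω‖ₑ) (G := G) 2
      (fun n => ((hMm n).sub hL).enorm)
      (Eventually.of_forall fun n => hLle.mono fun ω hω => by
        refine (enorm_sub_le).trans ((add_le_add (hMle ω n) hω).trans (le_of_eq ?_))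
        rw [← two_mul]; rfl) hG
      (hML.mono fun ω hω => by
        have := (tendsto_sub_nhds_zero_iff.2 hω).enorm
        rwa [enorm_zero] at this)
    have h2 := (ENNReal.continuous_rpow_const (y := (1 / 2 : ℝ))).tendsto 0 |>.comp h
    rw [ENNReal.zero_rpow_of_pos (by norm_num)] at h2
    exact h2.congr fun n => (hnorm _).symm
  have hcont : Continuous fun t : ℝ≥0 =>
      p * (γ + 1) / (p * (γ + 1) - γ) * (t : ℝ) ^ (p * (γ + 1) - γ) :=
    continuous_const.mul ((Real.continuous_rpow_const hδ.le).comp NNReal.continuous_coe)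
  let Y : Ω → SkorokhodSpace := fun ω => SkorokhodSpace.ofContinuous
    (fun t => p * (γ + 1) / (p * (γ + 1) - γ) * (t : ℝ) ^ (p * (γ + 1) - γ) * L ω)
    (hcont.mul continuous_const)
  have hdist : ∀ (T : ℝ≥0) n ω, ⨆ t : Icc (0 : ℝ≥0) T,
      edist (process p μ ξ α β n ω t) (Y ω t) ≤ deviation γ p μ T n (steps ξ α β ω) (L ω) :=
    fun T n ω => iSup_edist_le_deviation T n (steps ξ α β ω) (L ω)
  have hdev : ∀ᵐ ω ∂P, ∀ T : ℝ≥0,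
      Tendsto (fun n => deviation γ p μ T n (steps ξ α β ω) (L ω)) atTop (𝓝 0) := by
    filter_upwards [hML, hKL] with ω h1 h2 T
    exact tendsto_deviation hγ hμ hp0 hp1 hδ hv h1 h2 T
  have hmeas : ∀ (T : ℝ≥0) n, Measurable fun ω => deviation γ p μ T n (steps ξ α β ω) (L ω) :=
    fun T n => measurable_deviation hinput hL T n
  refine ⟨Y, fun _ _ => rfl, ?_, measurable_process hinput, ?_, ?_, fun T => ?_⟩
  · exact (SkorokhodSpace.continuous_ofContinuous_mul _ hcont).measurable.comp hL
  · filter_upwards [hdev] with ω hω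
    exact SkorokhodSpace.tendsto_of_forall_iSup_edist fun T =>
      tendsto_of_tendsto_of_tendsto_of_le_of_le tendsto_const_nhds (hω T) (fun _ => zero_le)
        fun n => hdist T n ω
  · -- the Skorohod distance itself is dominated by a measurable function with values in `[0, 1]`
    have h := tendsto_lintegral_sq_of_dominated (P := P) (G := fun _ => 1) (f := fun n ω =>
      ∑' m : ℕ, (2⁻¹ : ℝ≥0∞) ^ (m + 1) *
        min 1 (deviation γ p μ ((m : ℝ≥0) + 1) n (steps ξ α β ω) (L ω))) 1
      (fun n => Measurable.tsum fun m => (measurable_const.min (hmeas _ n)).const_mul _)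
      (Eventually.of_forall fun n => Eventually.of_forall fun ω => by
        rw [ENNReal.coe_one, one_mul]
        refine le_of_le_of_eq (ENNReal.tsum_le_tsum fun m => ?_) tsum_two_inv_pow_succ
        exact mul_le_of_le_one_right zero_le (min_le_left _ _))
      (by simp) (hdev.mono fun ω hω => tendsto_tsum_two_inv_pow_mul_min fun m => hω _)
    refine tendsto_of_tendsto_of_tendsto_of_le_of_le tendsto_const_nhds h (fun _ => zero_le)
      fun n => lintegral_mono fun ω => pow_le_pow_left' ?_ 2
    refine (SkorokhodSpace.edist_le_tsum _ _).trans (ENNReal.tsum_le_tsum fun m => ?_)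
    exact mul_le_mul_right (min_le_min le_rfl (hdist _ n ω)) _
  · obtain ⟨C, hC⟩ := exists_deviation_le hγ hμ hp0 hp1 hδ T
    have h := tendsto_lintegral_sq_of_dominated (P := P) C (hmeas T)
      (hC.mono fun n hn => hLle.mono fun ω hω => hn _ _ (G ω) (hMle ω) (hKle ω) hω) hG
      (hdev.mono fun ω hω => hω T)
    exact tendsto_of_tendsto_of_tendsto_of_le_of_le tendsto_const_nhds h (fun _ => zero_le)
      fun n => lintegral_mono fun ω => pow_le_pow_left' (hdist T n ω) 2
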